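/- Let $d\ge 1$, $Q=[0,1)^d$, $Q'=[0,2\pi)^d$. Let $Q_1\subset Q$ be relatively open, let $Q_0$ be the interior of $Q\setminus Q_1$, and assume that $\overline{Q_0}\subset(0,1)^d$ and that $Q\setminus(Q_0\cup Q_1)$ is a Lebesgue null set; if $d=1$, assume $Q_0=\emptyset$. Let $\nu>0$ and let $A_0,A_1$ be real symmetric $d\times d$ matrix functions on $Q$ with entries in $L^\infty(Q)$ such that $A_0\ge\nu I$ a.e. on $Q$, $A_1\ge\nu I$ a.e. on $Q_1$ and $A_1=0$ a.e. on $Q_0$. Let $H^1_\#(Q)$ be the space of $\mathbb Z^d$-periodic functions in $H^1_{\rm loc}(\mathbb R^d)$ and, for $\xi\in\mathbb R^d$, put $$A^{\rm hom}\xi\cdot\xi=\inf_{u\in H^1_\#(Q)}\int_Q A_1(\xi+\nabla u)\cdot\overline{(\xi+\nabla u)} .$$ Functions on $Q_0$ are extended by zero to $Q$, and $\mathcal H_0=\mathbb C\times H^1_0(Q_0)$. Let $\mathcal L=\{c+\tilde u:\ c\in\mathbb C,\ \tilde u\in L^2(Q),\ \tilde u=0 \text{ a.e. on } Q_1\}$,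 let $\mathcal I:\mathbb C\times L^2(Q_0)\to\mathcal L$, $\mathcal I(c,u)=c+u$, and let $\mathcal P_{\rm f}$ and $\mathcal P_0$ be the orthogonal projections of $L^2(Q)$ onto $\mathcal L$ and onto $L^2(Q_0)$. Equip $\mathbb C\times L^2(Q_0)$ with the inner product $(p,q)_0=(\mathcal I p,\mathcal I q)_{L^2(Q)}$. For $\varepsilon>0$ and $\theta\in\varepsilon^{-1}Q'$ let $\mathcal B^{\rm hom}_{\varepsilon,\theta}$ be the operator in $\mathbb C\times L^2(Q_0)$ associated with the form $$\mathfrak b^{\rm hom}_{\varepsilon,\theta}\big((c,u),(e,v)\big)=(A^{\rm hom}\theta\cdot\theta)\,c\,\overline e+\int_Q A_0(\nabla+i\varepsilon\theta)u\cdot\overline{(\nabla+i\varepsilon\theta)v},\qquad (c,u),(e,v)\in\mathcal H_0,$$ and let $\mathcal B_0$ be the operator in $L^2(Q_0)$ associated with the form $\int_{Q_0}A_0\nabla u\cdot\overline{\nabla v}$, $u,v\in H^1_0(Q_0)$. For a function $g$ let $[g]$ denote multiplication by $g$. Then $\mathcal I$ is a linear homeomorphism onto $\mathcal L$, the inverses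 $(\mathcal B_0+I)^{-1}$ and $(\mathcal B^{\rm hom}_{\varepsilon,\theta}+I)^{-1}$ exist as bounded everywhere defined operators, and there is a constant $C>0$, independent of $\varepsilon$ and $\theta$, such that $$\Big\|[e^{-i\varepsilon\theta\cdot y}](\mathcal B_0+I)^{-1}\mathcal P_0[e^{i\varepsilon\theta\cdot y}]-\mathcal I(\mathcal B^{\rm hom}_{\varepsilon,\theta}+I)^{-1}\mathcal I^{-1}\mathcal P_{\rm f}\Big\|_{L^2(Q)\to L^2(Q)}\le C\varepsilon$$ for all $\varepsilon>0$ and all $\theta\in\varepsilon^{-1}Q'$ with $|\theta|\ge\varepsilon^{-1/2}$. -/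

import Mathlib

open MeasureTheory

noncomputable section

namespace DoublePorosity

/-- Euclidean space `ℝ^d`. -/
abbrev E (d : ℕ) : Type := EuclideanSpace ℝ (Fin d)

/-- The unit cell `Q = [0,1)^d`. -/
def cell (d : ℕ) : Set (E d) := {x | ∀ i, x i ∈ Set.Ico (0 : ℝ) 1}

/-- The dual cell `Q' = [0,2π)^d`. -/
def dualCell (d : ℕ) : Set (E d) := {x | ∀ i, x i ∈ Set.Ico (0 : ℝ) (2 * Real.pi)}

/-- The soft component `Q₀`, the interior of `Q \ Q₁`. -/
def soft {d : ℕ} (Q₁ : Set (E d)) : Set (E d) := interior (cell d \ Q₁)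

/-- Lebesgue measure on `Q`. -/
def cellMeasure (d : ℕ) : Measure (E d) := volume.restrict (cell d)

instance cellMeasure_isFinite (d : ℕ) : IsFiniteMeasure (cellMeasure d) := by
  refine ⟨?_⟩
  rw [cellMeasure, Measure.restrict_apply_univ]
  refine Bornology.IsBounded.measure_lt_top ?_
  refine (Metric.isBounded_iff_subset_closedBall (0 : E d)).2 ⟨Real.sqrt d, fun x hx => ?_⟩
  rw [mem_closedBall_zero_iff, EuclideanSpace.norm_eq]
  apply Real.sqrt_le_sqrt
  calc ∑ i, ‖x i‖ ^ 2 ≤ ∑ _i : Fin d, (1 : ℝ) := by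
        refine Finset.sum_le_sum fun i _ => ?_
        obtain ⟨h0, h1⟩ := hx i
        rw [Real.norm_eq_abs, sq_abs]
        nlinarith
    _ = d := by simp

/-- The complex Hilbert space `L²(Q)`. -/
abbrev L2Q (d : ℕ) : Type := Lp ℂ 2 (cellMeasure d)

/-- `∫_Q A p · conj q` for vector fields `p`, `q`. -/
def energy {d : ℕ} (A : E d → Matrix (Fin d) (Fin d) ℝ) (p q : Fin d → E d → ℂ) : ℂ :=
  ∫ x, ∑ i, ∑ j, (A x i j : ℂ) * p j x * (starRingEnd ℂ) (q i x) ∂(cellMeasure d)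

/-- The standing assumptions on the geometry of the cell: `Q₁` is a (relatively) open subset of `Q`,
the closure of `Q₀` lies in `(0,1)^d`, and `Q₀`, `Q₁` fill `Q` up to a null set.  In dimension one
the connectedness of the periodic extension of `Q₁` forces `Q₀ = ∅`. -/
structure IsStiffSet {d : ℕ} (Q₁ : Set (E d)) : Prop where
  relOpen : ∃ U : Set (E d), IsOpen U ∧ Q₁ = cell d ∩ U
  soft_inside : closure (soft Q₁) ⊆ {x | ∀ i, x i ∈ Set.Ioo (0 : ℝ) 1}
  fill : volume (cell d \ (Q₁ ∪ soft Q₁)) = 0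
  dim : 2 ≤ d ∨ soft Q₁ = ∅

/-- `A` is a symmetric matrix function on `Q` with entries in `L^∞(Q)`. -/
structure IsCoefficient {d : ℕ} (A : E d → Matrix (Fin d) (Fin d) ℝ) : Prop where
  bounded : ∀ i j, MemLp (fun x => A x i j) ⊤ (cellMeasure d)
  symm : ∀ᵐ x ∂(cellMeasure d), (A x).IsSymm

/-- `A ≥ ν I` almost everywhere on `s`. -/
def EllipticOn {d : ℕ} (A : E d → Matrix (Fin d) (Fin d) ℝ) (ν : ℝ) (s : Set (E d)) : Prop :=
  ∀ᵐ x ∂(volume.restrict s), ∀ ξ : Fin d → ℝ,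
    ν * ∑ i, ξ i ^ 2 ≤ ∑ i, ∑ j, A x i j * ξ j * ξ i

/-- `u ∈ H¹_#(Q)`, i.e. `u` is `ℤ^d`-periodic and in `H¹_loc(ℝ^d)`, with weak gradient `g`. -/
structure IsPeriodicH1 {d : ℕ} (u : E d → ℂ) (g : Fin d → E d → ℂ) : Prop where
  periodic : ∀ (i : Fin d) (x : E d), u (x + EuclideanSpace.single i 1) = u x
  memLp : ∀ K : Set (E d), IsCompact K → MemLp u 2 (volume.restrict K)
  grad_memLp : ∀ (j : Fin d) (K : Set (E d)), IsCompact K → MemLp (g j) 2 (volume.restrict K)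
  weak_grad : ∀ (j : Fin d) (φ : E d → ℂ), ContDiff ℝ ((⊤ : ℕ∞) : WithTop ℕ∞) φ →
    HasCompactSupport φ →
    ∫ x, u x * fderiv ℝ φ x (EuclideanSpace.single j 1) = - ∫ x, g j x * φ x

/-- The quadratic form `A^hom ξ · ξ` of the homogenised matrix: the least value (infimum) of
`∫_Q A₁ (ξ + ∇u) · conj (ξ + ∇u)` over `u ∈ H¹_#(Q)`. -/
def homForm {d : ℕ} (A₁ : E d → Matrix (Fin d) (Fin d) ℝ) (ξ : E d) : ℝ :=
  sInf {r : ℝ | ∃ (u : E d → ℂ) (g : Fin d → E d → ℂ), IsPeriodicH1 u g ∧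
    r = (energy A₁ (fun j x => (ξ j : ℂ) + g j x) (fun j x => (ξ j : ℂ) + g j x)).re}

/-- The functions in `L²(Q)` that vanish almost everywhere on `s ⊆ Q`. -/
def vanishOn {d : ℕ} (s : Set (E d)) : Submodule ℂ (L2Q d) where
  carrier := {f | f =ᵐ[(cellMeasure d).restrict s] 0}
  zero_mem' := ae_restrict_of_ae (Lp.coeFn_zero _ _ _)
  add_mem' := by
    intro a b ha hb
    filter_upwards [ha, hb, ae_restrict_of_ae (Lp.coeFn_add a b)] with x h1 h2 h3
    simp_all
  smul_mem' := by
    intro c a ha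
    filter_upwards [ha, ae_restrict_of_ae (Lp.coeFn_smul c a)] with x h1 h2
    simp_all

theorem isClosed_vanishOn {d : ℕ} (s : Set (E d)) :
    IsClosed ((vanishOn s : Submodule ℂ (L2Q d)) : Set (L2Q d)) := by
  have : ((vanishOn s : Submodule ℂ (L2Q d)) : Set (L2Q d)) =
      (LpToLpRestrictCLM (E d) ℂ ℂ (cellMeasure d) 2 s) ⁻¹' {0} := by
    ext f
    have h := LpToLpRestrictCLM_coeFn (μ := cellMeasure d) (p := 2) ℂ s f
    rw [Set.mem_preimage, Set.mem_singleton_iff, Lp.eq_zero_iff_ae_eq_zero]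
    exact ⟨fun hf => h.trans hf, fun hf => h.symm.trans hf⟩
  rw [this]
  exact isClosed_singleton.preimage (ContinuousLinearMap.continuous _)

/-- `L²(Q₀)`, identified with the functions in `L²(Q)` that vanish almost everywhere off `Q₀`. -/
def L2soft {d : ℕ} (Q₁ : Set (E d)) : Submodule ℂ (L2Q d) := vanishOn (cell d \ soft Q₁)

instance L2soft_complete {d : ℕ} (Q₁ : Set (E d)) : CompleteSpace (L2soft Q₁) :=
  (isClosed_vanishOn _).completeSpace_coe

/-- The constant function `c` as an element of `L²(Q)`. -/
def const (d : ℕ) : ℂ →L[ℂ] L2Q d := Lp.constL 2 (cellMeasure d) ℂ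

/-- The subspace `𝓛 = {c + ũ : c ∈ ℂ, ũ ∈ L²(Q), ũ = 0 on Q₁}` of `L²(Q)`. -/
def calL {d : ℕ} (Q₁ : Set (E d)) : Submodule ℂ (L2Q d) :=
  vanishOn Q₁ ⊔ LinearMap.range (const d).toLinearMap

instance calL_complete {d : ℕ} (Q₁ : Set (E d)) : CompleteSpace (calL Q₁) :=
  (Submodule.isClosed_sup_finiteDimensional _ _ (isClosed_vanishOn Q₁)).completeSpace_coe

/-- Pairs `(φ, ∇φ)` with `φ ∈ C_c^∞(Q₀)`. -/
def testPairs {d : ℕ} (Q₁ : Set (E d)) : Set (L2Q d × (Fin d → L2Q d)) :=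
  {p | ∃ φ : E d → ℂ, ContDiff ℝ ((⊤ : ℕ∞) : WithTop ℕ∞) φ ∧ HasCompactSupport φ ∧
    tsupport φ ⊆ soft Q₁ ∧ p.1 =ᵐ[cellMeasure d] φ ∧
    ∀ j, p.2 j =ᵐ[cellMeasure d] fun x => fderiv ℝ φ x (EuclideanSpace.single j 1)}

/-- `H¹₀(Q₀)` as the set of pairs `(u, ∇u)` (extended by zero to `Q`): the closure of
`C_c^∞(Q₀)` in the `H¹` norm. -/
def H10 {d : ℕ} (Q₁ : Set (E d)) : Set (L2Q d × (Fin d → L2Q d)) := closure (testPairs Q₁)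

/-- The shifted gradient `(∇ + iκ) u` of a pair `(u, ∇u)`. -/
def shiftGrad {d : ℕ} (κ : E d) (p : L2Q d × (Fin d → L2Q d)) : Fin d → E d → ℂ :=
  fun j x => p.2 j x + Complex.I * (κ j : ℂ) * p.1 x

/-- The operator `𝓑₀` in `L²(Q₀)` (given by its graph) generated by the form
`∫_Q A₀ ∇u · conj ∇v` on `H¹₀(Q₀)`. -/
def B0 {d : ℕ} (Q₁ : Set (E d)) (A₀ : E d → Matrix (Fin d) (Fin d) ℝ) :
    Set (L2soft Q₁ × L2soft Q₁) :=
  {p | ∃ g, ((p.1 : L2Q d), g) ∈ H10 Q₁ ∧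
    ∀ (v : L2soft Q₁) (h : Fin d → L2Q d), ((v : L2Q d), h) ∈ H10 Q₁ →
      inner ℂ (v : L2Q d) (p.2 : L2Q d) =
        energy A₀ (shiftGrad 0 ((p.1 : L2Q d), g)) (shiftGrad 0 ((v : L2Q d), h))}

/-- The function `c + ũ` in `L²(Q)` for `(c, u) ∈ ℂ × L²(Q₀)`. -/
def ident {d : ℕ} (Q₁ : Set (E d)) (p : ℂ × L2soft Q₁) : L2Q d := const d p.1 + (p.2 : L2Q d)

/-- The operator `𝓑^hom_{ε,θ}` in `ℂ × L²(Q₀)` (given by its graph), generated by the form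
`A^hom θ·θ c conj d + ∫_Q A₀ (∇ + iεθ)u · conj ((∇ + iεθ)v)` on `ℂ × H¹₀(Q₀)` with respect to the
inner product `((c,u),(d,v))₀ = (c + ũ, d + ṽ)_{L²(Q)}`. -/
def Bhom {d : ℕ} (Q₁ : Set (E d)) (A₀ A₁ : E d → Matrix (Fin d) (Fin d) ℝ) (ε : ℝ) (θ : E d) :
    Set ((ℂ × L2soft Q₁) × (ℂ × L2soft Q₁)) :=
  {p | ∃ g, ((p.1.2 : L2Q d), g) ∈ H10 Q₁ ∧
    ∀ (e : ℂ) (v : L2soft Q₁) (h : Fin d → L2Q d), ((v : L2Q d), h) ∈ H10 Q₁ →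
      inner ℂ (ident Q₁ (e, v)) (ident Q₁ p.2) =
        (homForm A₁ θ : ℂ) * p.1.1 * (starRingEnd ℂ) e +
          energy A₀ (shiftGrad (ε • θ) ((p.1.2 : L2Q d), g))
            (shiftGrad (ε • θ) ((v : L2Q d), h))}

/-- `R` is the bounded operator `(B + I)⁻¹`, where `B` is an operator given by its graph:
`R f = x` if and only if `x` lies in the domain of `B` and `B x + x = f`. -/
def IsResolvent {X : Type*} [AddCommGroup X] [Module ℂ X] [TopologicalSpace X]
    (B : Set (X × X)) (R : X →L[ℂ] X) : Prop :=
  ∀ f x, R f = x ↔ (x, f - x) ∈ B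

/-- The exponential `y ↦ e^{iκ·y}`. -/
def expWave {d : ℕ} (κ : E d) (y : E d) : ℂ := Complex.exp (Complex.I * (inner ℝ κ y : ℝ))

theorem norm_expWave {d : ℕ} (κ y : E d) : ‖expWave κ y‖ = 1 := by
  rw [expWave, mul_comm]; exact Complex.norm_exp_ofReal_mul_I _

theorem memLp_expWave_mul {d : ℕ} (κ : E d) (f : L2Q d) :
    MemLp (fun y => expWave κ y * f y) 2 (cellMeasure d) := by
  refine (Lp.memLp f).of_le ?_ (Filter.Eventually.of_forall fun y => ?_)
  · refine AEStronglyMeasurable.mul ?_ (Lp.aestronglyMeasurable f)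
    have : Continuous (expWave κ) := by unfold expWave; fun_prop
    exact this.aestronglyMeasurable
  · rw [norm_mul, norm_expWave, one_mul]

/-- The operator of multiplication by `e^{iκ·y}` in `L²(Q)`. -/
def mulExp {d : ℕ} (κ : E d) : L2Q d →L[ℂ] L2Q d :=
  LinearMap.mkContinuous
    { toFun := fun f => (memLp_expWave_mul κ f).toLp _
      map_add' := by
        intro f g
        rw [← MemLp.toLp_add, MemLp.toLp_eq_toLp_iff]
        filter_upwards [Lp.coeFn_add f g] with y h
        rw [h, Pi.add_apply, Pi.add_apply, mul_add]
      map_smul' := by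
        intro c f
        rw [RingHom.id_apply, ← MemLp.toLp_const_smul, MemLp.toLp_eq_toLp_iff]
        filter_upwards [Lp.coeFn_smul c f] with y h
        rw [h, Pi.smul_apply, Pi.smul_apply, smul_eq_mul, smul_eq_mul]
        ring } 1 (by
      intro f
      rw [one_mul]
      refine Lp.norm_le_norm_of_ae_le ?_
      filter_upwards [(memLp_expWave_mul κ f).coeFn_toLp] with y h
      simp only [LinearMap.coe_mk, AddHom.coe_mk]
      rw [h, norm_mul, norm_expWave, one_mul])

end DoublePorosity

end

open DoublePorosity

open MeasureTheory
open DoublePorosity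

namespace DoublePorosity

/-! ### Resolvents of operators generated by coercive forms -/

/-! Put κ = εθ and a = A^hom θ·θ. Multiplication by e^{iκ·y} is unitary, preserves H¹₀(Q₀) and turns
∇ into ∇ + iκ. Hence for f in L²(Q) the first operator gives the solution W of the Dirichlet problem
on Q₀ with datum f and form a_κ(u,v) = ∫ A₀(∇+iκ)u · conj((∇+iκ)v). The second gives X = c + U,
which solves the problem on ℂ × H¹₀(Q₀) with the same datum and with a c ē added to the form.

Three test pairs compare them (`mul_norm_sub_le`). The pair (c,U) gives ‖X‖ ≤ ‖f‖. The pair (c,0)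
gives a|c| ≤ 2‖1‖‖f‖. Finally U − W solves the Dirichlet problem with datum −c, so ‖U − W‖ ≤ ‖c‖.
Together a‖W − X‖ ≤ 4‖1‖²‖f‖: a large stiffness a suppresses the constant, and with it the
difference.

It remains to see that a ≥ c₀|θ|² ≥ c₀/ε (`exists_le_homForm`). Since Q₀ keeps a distance δ from the
faces of the cell, the tube along the i-th axis whose other coordinates lie in (0,δ) avoids Q₀ and
closes up by periodicity. Against a cutoff η of those other coordinates, ∂ᵢu has mean zero, and
completing the square bounds the energy below by ν ξᵢ² ∫η.

The resolvents come from the Lax–Milgram argument in this first lemma. There `j` supplies the inner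
product of `X`, whose own norm need not be Hilbertian: for ℂ × L²(Q₀) it is the sup norm. -/

theorem exists_resolvent_of_coercive {V X H : Type*}
    [NormedAddCommGroup V] [InnerProductSpace ℂ V] [CompleteSpace V]
    [NormedAddCommGroup X] [NormedSpace ℂ X]
    [NormedAddCommGroup H] [InnerProductSpace ℂ H] [CompleteSpace H]
    (T : V →L[ℂ] V) (ι : V →L[ℂ] X) (j : X →L[ℂ] H) {c : ℝ} (hc : 0 < c)
    (hT : ∀ v, c * ‖v‖ ^ 2 ≤ (inner ℂ v (T v)).re + ‖j (ι v)‖ ^ 2) :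
    ∃ R : X →L[ℂ] X, ∀ f x, R f = x ↔
      ∃ v, ι v = x ∧ ∀ w, inner ℂ (j (ι w)) (j (f - x)) = inner ℂ w (T v) := by
  set K : V →L[ℂ] H := j ∘L ι with hK
  -- `G` represents the form plus the pulled-back inner product. It is coercive, hence invertible,
  -- and the resolvent is ι G⁻¹ K* j.
  set G : V →L[ℂ] V := T + K.adjoint ∘L K with hG
  have hKv : ∀ v, K v = j (ι v) := fun _ => rfl
  have hGi : ∀ w v, inner ℂ w (G v) = inner ℂ w (T v) + inner ℂ (K w) (K v) := by
    intro w v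
    simp [hG, ContinuousLinearMap.adjoint_inner_right]
  have hGu : IsUnit G := by
    refine ContinuousLinearMap.isUnit_of_forall_le_norm_inner_map G (c := ⟨c, hc.le⟩) hc ?_
    intro v
    rw [norm_inner_symm]
    refine le_trans ?_ (Complex.re_le_norm _)
    rw [hGi, Complex.add_re, inner_self_eq_norm_sq_to_K]
    have := hT v
    rw [← hKv] at this
    have h2 : (((‖K v‖ : ℂ)) ^ 2).re = ‖K v‖ ^ 2 := by norm_cast
    simp only [Complex.coe_algebraMap, h2]
    change ‖v‖ ^ 2 * c ≤ _
    linarith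
  obtain ⟨U, hU⟩ := hGu
  have h1 : ∀ v, G ((↑U⁻¹ : V →L[ℂ] V) v) = v := fun v => by
    have := congrArg (fun F : V →L[ℂ] V => F v) U.mul_inv
    rw [hU] at this
    exact this
  have h2 : ∀ v, (↑U⁻¹ : V →L[ℂ] V) (G v) = v := fun v => by
    have := congrArg (fun F : V →L[ℂ] V => F v) U.inv_mul
    rw [hU] at this
    exact this
  refine ⟨ι ∘L (↑U⁻¹ : V →L[ℂ] V) ∘L K.adjoint ∘L j, fun f x => ?_⟩
  have key : ∀ v, (∀ w, inner ℂ (j (ι w)) (j (f - ι v)) = inner ℂ w (T v)) ↔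
      G v = K.adjoint (j f) := by
    intro v
    rw [← sub_eq_zero]
    constructor
    · intro h
      refine ext_inner_left ℂ fun z => ?_
      rw [inner_zero_right]
      rw [inner_sub_right, hGi, ContinuousLinearMap.adjoint_inner_right, ← h, hKv, hKv, map_sub,
        inner_sub_right]
      ring
    · intro h w
      rw [sub_eq_zero] at h
      have := hGi w v
      rw [h, ContinuousLinearMap.adjoint_inner_right, hKv, hKv] at this
      rw [map_sub, inner_sub_right, this]
      ring
  constructor
  · rintro rfl
    refine ⟨(↑U⁻¹ : V →L[ℂ] V) (K.adjoint (j f)), rfl, ?_⟩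
    exact (key _).2 (h1 _)
  · rintro ⟨v, rfl, hv⟩
    have := (key v).1 hv
    change ι ((↑U⁻¹ : V →L[ℂ] V) (K.adjoint (j f))) = _
    rw [← this, h2]

/-- The variant of `exists_resolvent_of_coercive` for a form `a z z̄' + (T v, v')` on `ℂ × V`. -/
theorem exists_resolvent_of_coercive_prod {V X H : Type*}
    [NormedAddCommGroup V] [InnerProductSpace ℂ V] [CompleteSpace V]
    [NormedAddCommGroup X] [NormedSpace ℂ X]
    [NormedAddCommGroup H] [InnerProductSpace ℂ H] [CompleteSpace H]
    (a : ℝ) (T : V →L[ℂ] V) (ι : V →L[ℂ] X) (j : (ℂ × X) →L[ℂ] H) {c : ℝ} (hc : 0 < c)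
    (hT : ∀ (z : ℂ) (v : V), c * (‖z‖ ^ 2 + ‖v‖ ^ 2) ≤
      a * ‖z‖ ^ 2 + (inner ℂ v (T v)).re + ‖j (z, ι v)‖ ^ 2) :
    ∃ R : (ℂ × X) →L[ℂ] (ℂ × X), ∀ f x, R f = x ↔
      ∃ v, ι v = x.2 ∧ ∀ z w, inner ℂ (j (z, ι w)) (j (f - x)) =
        (a : ℂ) * x.1 * (starRingEnd ℂ) z + inner ℂ w (T v) := by
  -- The form domain must be a Hilbert space, so ℂ × V carries the ℓ² product norm here.
  let P₁ := WithLp.fstL 2 ℂ ℂ V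
  let P₂ := WithLp.sndL 2 ℂ ℂ V
  let S : WithLp 2 (ℂ × V) →L[ℂ] WithLp 2 (ℂ × V) :=
    (a : ℂ) • (P₁.adjoint ∘L P₁) + P₂.adjoint ∘L T ∘L P₂
  have hS : ∀ w v, inner ℂ w (S v) =
      (a : ℂ) * v.fst * (starRingEnd ℂ) w.fst + inner ℂ w.snd (T v.snd) := by
    intro w v
    have h1 : S v = (a : ℂ) • P₁.adjoint v.fst + P₂.adjoint (T v.snd) := rfl
    rw [h1, inner_add_right, inner_smul_right, ContinuousLinearMap.adjoint_inner_right,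
      ContinuousLinearMap.adjoint_inner_right, mul_assoc]
    rfl
  obtain ⟨R, hR⟩ := exists_resolvent_of_coercive S (P₁.prod (ι ∘L P₂)) j hc (by
    intro v
    have h2 : (inner ℂ v (S v)).re = a * ‖v.fst‖ ^ 2 + (inner ℂ v.snd (T v.snd)).re := by
      rw [hS, Complex.add_re, mul_assoc, Complex.mul_conj', Complex.re_ofReal_mul]
      norm_cast
    rw [h2, WithLp.prod_norm_sq_eq_of_L2]
    exact hT v.fst v.snd)
  refine ⟨R, fun f x => (hR f x).trans ⟨?_, ?_⟩⟩
  · rintro ⟨v, rfl, hv⟩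
    exact ⟨v.snd, rfl, fun z w => (hv (WithLp.toLp 2 (z, w))).trans (hS (WithLp.toLp 2 (z, w)) v)⟩
  · rintro ⟨v, hv, h⟩
    refine ⟨WithLp.toLp 2 (x.1, v), Prod.ext rfl hv, fun w => ?_⟩
    exact (h w.fst w.snd).trans (hS w (WithLp.toLp 2 (x.1, v))).symm

/-! ### The energy form -/

section Energy

variable {d : ℕ} {A : E d → Matrix (Fin d) (Fin d) ℝ} {p q p' q' : Fin d → E d → ℂ}

theorem energy_congr (hp : ∀ i, p i =ᵐ[cellMeasure d] p' i)
    (hq : ∀ i, q i =ᵐ[cellMeasure d] q' i) : energy A p q = energy A p' q' := by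
  refine integral_congr_ae ?_
  filter_upwards [ae_all_iff.2 hp, ae_all_iff.2 hq] with x h1 h2
  simp only [h1, h2]

theorem integrable_coefficient_mul (hA : IsCoefficient A) {f g : E d → ℂ} (i j : Fin d)
    (hf : MemLp f 2 (cellMeasure d)) (hg : MemLp g 2 (cellMeasure d)) :
    Integrable (fun x => (A x i j : ℂ) * f x * (starRingEnd ℂ) (g x)) (cellMeasure d) := by
  have h1 : MemLp (fun x => (A x i j : ℂ)) ⊤ (cellMeasure d) := (hA.bounded i j).ofReal
  have h2 : MemLp (fun x => (A x i j : ℂ) * f x) 2 (cellMeasure d) := hf.mul' h1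
  exact h2.integrable_mul hg.star

theorem integrable_energy (hA : IsCoefficient A) (hp : ∀ i, MemLp (p i) 2 (cellMeasure d))
    (hq : ∀ i, MemLp (q i) 2 (cellMeasure d)) :
    Integrable (fun x => ∑ i, ∑ j, (A x i j : ℂ) * p j x * (starRingEnd ℂ) (q i x))
      (cellMeasure d) :=
  integrable_finsetSum _ fun i _ => integrable_finsetSum _ fun j _ =>
    integrable_coefficient_mul hA i j (hp j) (hq i)

theorem energy_eq_sum (hA : IsCoefficient A) (hp : ∀ i, MemLp (p i) 2 (cellMeasure d))
    (hq : ∀ i, MemLp (q i) 2 (cellMeasure d)) :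
    energy A p q = ∑ i, ∑ j,
      ∫ x, (A x i j : ℂ) * p j x * (starRingEnd ℂ) (q i x) ∂(cellMeasure d) := by
  rw [energy, integral_finsetSum _ fun i _ => integrable_finsetSum _ fun j _ =>
    integrable_coefficient_mul hA i j (hp j) (hq i)]
  exact Finset.sum_congr rfl fun i _ => integral_finsetSum _ fun j _ =>
    integrable_coefficient_mul hA i j (hp j) (hq i)

/-- A lower bound for a real quadratic form carries over to complex vectors. -/
theorem re_quadratic_ge {n : ℕ} {M : Matrix (Fin n) (Fin n) ℝ} {w : ℝ}
    (hM : ∀ ξ : Fin n → ℝ, w * ∑ i, ξ i ^ 2 ≤ ∑ i, ∑ j, M i j * ξ j * ξ i) (z : Fin n → ℂ) :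
    w * ∑ i, ‖z i‖ ^ 2 ≤ (∑ i, ∑ j, (M i j : ℂ) * z j * (starRingEnd ℂ) (z i)).re := by
  have h1 := hM fun i => (z i).re
  have h2 := hM fun i => (z i).im
  have h3 : (∑ i, ∑ j, (M i j : ℂ) * z j * (starRingEnd ℂ) (z i)).re =
      (∑ i, ∑ j, M i j * (z j).re * (z i).re) + ∑ i, ∑ j, M i j * (z j).im * (z i).im := by
    simp only [Complex.re_sum, ← Finset.sum_add_distrib]
    refine Finset.sum_congr rfl fun i _ => Finset.sum_congr rfl fun j _ => ?_
    simp
  have h4 : ∑ i, ‖z i‖ ^ 2 = ∑ i, (z i).re ^ 2 + ∑ i, (z i).im ^ 2 := by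
    rw [← Finset.sum_add_distrib]
    refine Finset.sum_congr rfl fun i _ => ?_
    rw [Complex.sq_norm, Complex.normSq_apply]
    ring
  rw [h3, h4]
  linarith

/-- The minorant `F` is left arbitrary because it also serves for a sign-changing `F`, in the lower
bound for the homogenised form. -/
theorem le_re_energy (hA : IsCoefficient A) (hp : ∀ i, MemLp (p i) 2 (cellMeasure d))
    {F : E d → ℝ} (hF : Integrable F (cellMeasure d))
    (h : ∀ᵐ x ∂(cellMeasure d),
      F x ≤ (∑ i, ∑ j, (A x i j : ℂ) * p j x * (starRingEnd ℂ) (p i x)).re) :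
    ∫ x, F x ∂(cellMeasure d) ≤ (energy A p p).re := by
  have hi := integrable_energy hA hp hp
  have : (energy A p p).re = ∫ x, (∑ i, ∑ j, (A x i j : ℂ) * p j x *
      (starRingEnd ℂ) (p i x)).re ∂(cellMeasure d) := (integral_re hi).symm
  rw [this]
  exact integral_mono_ae hF hi.re h

end Energy

/-! ### Multiplication operators and shifted gradients on L²(Q) -/

section Operators

variable {d : ℕ}

/-- Square integrable complex vector fields on the cell. -/
abbrev Field2 (d : ℕ) : Type := PiLp 2 (fun _ : Fin d => L2Q d)

/-- Multiplication by an essentially bounded real function in `L²(Q)`. -/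
noncomputable def mulBounded {a : E d → ℝ} (ha : MemLp a ⊤ (cellMeasure d)) : L2Q d →L[ℂ] L2Q d :=
  (ContinuousLinearMap.mul ℂ ℂ).holderL (cellMeasure d) ⊤ 2 2 ((ha.ofReal (K := ℂ)).toLp _)

theorem coeFn_mulBounded {a : E d → ℝ} (ha : MemLp a ⊤ (cellMeasure d)) (f : L2Q d) :
    mulBounded ha f =ᵐ[cellMeasure d] fun x => (a x : ℂ) * f x := by
  filter_upwards [(ContinuousLinearMap.mul ℂ ℂ).coeFn_holder (r := 2)
    ((ha.ofReal (K := ℂ)).toLp _) f, (ha.ofReal (K := ℂ)).coeFn_toLp] with x h1 h2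
  rw [mulBounded, ContinuousLinearMap.holderL_apply_apply, h1, h2]
  simp

/-- Multiplication of vector fields by the matrix function `A`. -/
noncomputable def mulMatrix {A : E d → Matrix (Fin d) (Fin d) ℝ} (hA : IsCoefficient A) :
    Field2 d →L[ℂ] Field2 d :=
  (PiLp.continuousLinearEquiv 2 ℂ (fun _ : Fin d => L2Q d)).symm.toContinuousLinearMap ∘L
    ContinuousLinearMap.pi fun i => ∑ j, mulBounded (hA.bounded i j) ∘L PiLp.proj 2 _ j

theorem mulMatrix_apply {A : E d → Matrix (Fin d) (Fin d) ℝ} (hA : IsCoefficient A)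
    (p : Field2 d) (i : Fin d) :
    mulMatrix hA p i = ∑ j, mulBounded (hA.bounded i j) (p j) := by
  simp [mulMatrix]

/-- Represents the energy by a bounded operator. The arguments swap because `inner` is
conjugate-linear in its first slot. -/
theorem inner_mulMatrix {A : E d → Matrix (Fin d) (Fin d) ℝ} (hA : IsCoefficient A)
    (p q : Field2 d) :
    inner ℂ q (mulMatrix hA p) = energy A (fun i => p i) (fun i => q i) := by
  rw [energy_eq_sum hA (fun i => Lp.memLp _) (fun i => Lp.memLp _), PiLp.inner_apply]
  refine Finset.sum_congr rfl fun i _ => ?_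
  rw [mulMatrix_apply, inner_sum]
  refine Finset.sum_congr rfl fun j _ => ?_
  rw [L2.inner_def]
  refine integral_congr_ae ?_
  filter_upwards [coeFn_mulBounded (hA.bounded i j) (p j)] with x hx
  rw [hx]
  simp

theorem norm_sq_eq_integral (f : L2Q d) : ‖f‖ ^ 2 = ∫ x, ‖f x‖ ^ 2 ∂(cellMeasure d) := by
  have h := inner_self_eq_norm_sq_to_K (𝕜 := ℂ) f
  have h2 : ((‖f‖ ^ 2 : ℝ) : ℂ) = ((∫ x, ‖f x‖ ^ 2 ∂(cellMeasure d) : ℝ) : ℂ) := by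
    rw [L2.inner_def] at h
    rw [← integral_complex_ofReal, Complex.ofReal_pow]
    refine h.symm.trans (integral_congr_ae (Filter.Eventually.of_forall fun x => ?_))
    simp [inner_self_eq_norm_sq_to_K]
  exact_mod_cast h2

theorem re_inner_mulMatrix_ge {A : E d → Matrix (Fin d) (Fin d) ℝ} (hA : IsCoefficient A)
    {ν : ℝ} (h : EllipticOn A ν (cell d)) (p : Field2 d) :
    ν * ‖p‖ ^ 2 ≤ (inner ℂ p (mulMatrix hA p)).re := by
  have hi : ∀ i, Integrable (fun x => ‖p i x‖ ^ 2) (cellMeasure d) := fun i =>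
    (Lp.memLp (p i)).integrable_norm_pow (by norm_num)
  rw [inner_mulMatrix, PiLp.norm_sq_eq_of_L2]
  have : ν * ∑ i, ‖p i‖ ^ 2 = ∫ x, ν * ∑ i, ‖p i x‖ ^ 2 ∂(cellMeasure d) := by
    rw [integral_const_mul, integral_finsetSum _ fun i _ => hi i]
    simp only [norm_sq_eq_integral]
  rw [this]
  refine le_re_energy hA (fun i => Lp.memLp _)
    ((integrable_finsetSum _ fun i _ => hi i).const_mul ν) ?_
  filter_upwards [h] with x hx
  exact re_quadratic_ge hx _

/-- `L²(Q)` functions together with vector fields, the ambient Hilbert space of `H¹₀(Q₀)`. -/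
abbrev Pair2 (d : ℕ) : Type := WithLp 2 (L2Q d × Field2 d)

/-- The shifted gradient `(u, g) ↦ g + iκu`. -/
noncomputable def shiftL (κ : E d) : Pair2 d →L[ℂ] Field2 d :=
  (PiLp.continuousLinearEquiv 2 ℂ (fun _ : Fin d => L2Q d)).symm.toContinuousLinearMap ∘L
    ContinuousLinearMap.pi fun j =>
      PiLp.proj 2 _ j ∘L WithLp.sndL 2 ℂ (L2Q d) (Field2 d) +
        (Complex.I * (κ j : ℂ)) • WithLp.fstL 2 ℂ (L2Q d) (Field2 d)

theorem shiftL_apply (κ : E d) (w : Pair2 d) (j : Fin d) :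
    shiftL κ w j = w.snd j + (Complex.I * (κ j : ℂ)) • w.fst := by
  simp [shiftL]

theorem coeFn_shiftL (κ : E d) (w : Pair2 d) (j : Fin d) :
    shiftL κ w j =ᵐ[cellMeasure d] shiftGrad κ (w.fst, fun i => w.snd i) j := by
  rw [shiftL_apply]
  filter_upwards [Lp.coeFn_add (w.snd j) ((Complex.I * (κ j : ℂ)) • w.fst),
    Lp.coeFn_smul (Complex.I * (κ j : ℂ)) w.fst] with x h1 h2
  rw [h1, Pi.add_apply, h2]
  simp [shiftGrad]

theorem energy_shiftGrad {A : E d → Matrix (Fin d) (Fin d) ℝ} (hA : IsCoefficient A) (κ : E d)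
    (v w : Pair2 d) :
    energy A (shiftGrad κ (v.fst, fun i => v.snd i)) (shiftGrad κ (w.fst, fun i => w.snd i)) =
      inner ℂ (shiftL κ w) (mulMatrix hA (shiftL κ v)) := by
  rw [inner_mulMatrix]
  exact energy_congr (fun i => (coeFn_shiftL κ v i).symm) (fun i => (coeFn_shiftL κ w i).symm)

/-- The gradient is controlled by the shifted gradient and the function. -/
theorem norm_sq_le_shiftL (κ : E d) :
    ∃ c : ℝ, 0 < c ∧ ∀ w : Pair2 d, c * ‖w‖ ^ 2 ≤ ‖shiftL κ w‖ ^ 2 + ‖w.fst‖ ^ 2 := by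
  set K : ℝ := ∑ j, ‖Complex.I * (κ j : ℂ)‖ ^ 2 with hK
  have hK0 : 0 ≤ K := Finset.sum_nonneg fun j _ => by positivity
  -- From ‖g‖² ≤ 2‖g + iκu‖² + 2K‖u‖² with K = |κ|², after adding ‖u‖².
  refine ⟨(2 + 2 * K)⁻¹, by positivity, fun w => ?_⟩
  have h1 : ‖w.snd‖ ^ 2 ≤ 2 * ‖shiftL κ w‖ ^ 2 + 2 * K * ‖w.fst‖ ^ 2 := by
    rw [PiLp.norm_sq_eq_of_L2, PiLp.norm_sq_eq_of_L2, hK, Finset.mul_sum, Finset.mul_sum,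
      Finset.sum_mul, ← Finset.sum_add_distrib]
    refine Finset.sum_le_sum fun j _ => ?_
    have h2 : w.snd j = shiftL κ w j - (Complex.I * (κ j : ℂ)) • w.fst := by
      rw [shiftL_apply]; abel
    have h3 : ‖w.snd j‖ ≤ ‖shiftL κ w j‖ + ‖Complex.I * (κ j : ℂ)‖ * ‖w.fst‖ := by
      rw [h2, ← norm_smul]
      exact norm_sub_le _ _
    have h4 := norm_nonneg (w.snd j)
    calc ‖w.snd j‖ ^ 2 ≤ (‖shiftL κ w j‖ + ‖Complex.I * (κ j : ℂ)‖ * ‖w.fst‖) ^ 2 := by gcongr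
      _ ≤ _ := by
        nlinarith [sq_nonneg (‖shiftL κ w j‖ - ‖Complex.I * (κ j : ℂ)‖ * ‖w.fst‖)]
  rw [WithLp.prod_norm_sq_eq_of_L2, inv_mul_le_iff₀ (by positivity)]
  nlinarith [sq_nonneg ‖shiftL κ w‖, sq_nonneg ‖w.fst‖, mul_nonneg hK0 (sq_nonneg ‖shiftL κ w‖)]

end Operators

/-! ### The space `H¹₀(Q₀)` -/

section Sobolev

variable {d : ℕ}

theorem measurableSet_cell (d : ℕ) : MeasurableSet (cell d) := by
  have : cell d = ⋂ i : Fin d, (fun x : E d => x i) ⁻¹' Set.Ico (0 : ℝ) 1 := by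
    ext x; simp [cell]
  rw [this]
  refine MeasurableSet.iInter fun i => measurableSet_Ico.preimage ?_
  fun_prop

theorem measurableSet_soft (Q₁ : Set (E d)) : MeasurableSet (soft Q₁) :=
  isOpen_interior.measurableSet

/-- The pairs `(φ, ∇φ)` with `φ ∈ C_c^∞(Q₀)` form a subspace. -/
def testSubmodule (Q₁ : Set (E d)) : Submodule ℂ (L2Q d × (Fin d → L2Q d)) where
  carrier := testPairs Q₁
  zero_mem' := by
    refine ⟨0, contDiff_const, HasCompactSupport.zero, ?_, Lp.coeFn_zero _ _ _, fun j => ?_⟩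
    · simp [tsupport]
    · filter_upwards [Lp.coeFn_zero ℂ 2 (cellMeasure d)] with x hx
      have : fderiv ℝ (0 : E d → ℂ) x = 0 := fderiv_const_apply 0
      rw [this]
      exact hx
  add_mem' := by
    rintro a b ⟨φ, hφ, hφc, hφs, ha, ha'⟩ ⟨ψ, hψ, hψc, hψs, hb, hb'⟩
    refine ⟨φ + ψ, hφ.add hψ, hφc.add hψc, ?_, ?_, fun j => ?_⟩
    · exact (tsupport_add φ ψ).trans (Set.union_subset hφs hψs)
    · exact (Lp.coeFn_add _ _).trans (ha.add hb)
    · filter_upwards [Lp.coeFn_add (a.2 j) (b.2 j), ha' j, hb' j] with x h1 h2 h3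
      have : fderiv ℝ (φ + ψ) x = fderiv ℝ φ x + fderiv ℝ ψ x :=
        fderiv_add (hφ.differentiable (by simp) x) (hψ.differentiable (by simp) x)
      rw [Prod.snd_add, Pi.add_apply, h1, Pi.add_apply, h2, h3, this]
      rfl
  smul_mem' := by
    rintro c a ⟨φ, hφ, hφc, hφs, ha, ha'⟩
    refine ⟨c • φ, hφ.const_smul c, hφc.smul_left (f := fun _ => c), ?_, ?_, fun j => ?_⟩
    · exact (closure_mono (Function.support_const_smul_subset c φ)).trans hφs
    · exact (Lp.coeFn_smul _ _).trans (ha.const_smul c)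
    · filter_upwards [Lp.coeFn_smul c (a.2 j), ha' j] with x h1 h2
      have : fderiv ℝ (c • φ) x = c • fderiv ℝ φ x :=
        fderiv_const_smul (hφ.differentiable (by simp) x) c
      rw [Prod.smul_snd, Pi.smul_apply, h1, Pi.smul_apply, h2, this]
      rfl

/-- `H¹₀(Q₀)` as a subspace of the Hilbert space of pairs. -/
noncomputable def sobolev (Q₁ : Set (E d)) : Submodule ℂ (Pair2 d) :=
  (testSubmodule Q₁).topologicalClosure.comap
    ((WithLp.fstL 2 ℂ (L2Q d) (Field2 d)).prod
      ((PiLp.continuousLinearEquiv 2 ℂ (fun _ : Fin d => L2Q d)).toContinuousLinearMap ∘L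
        WithLp.sndL 2 ℂ (L2Q d) (Field2 d))).toLinearMap

/-- Taking `sobolev` as a preimage under the coordinate map makes this definitional, so the graph
definitions and the Hilbert space problems translate freely. -/
theorem mem_sobolev {Q₁ : Set (E d)} {w : Pair2 d} :
    w ∈ sobolev Q₁ ↔ (w.fst, fun j => w.snd j) ∈ H10 Q₁ := Iff.rfl

instance completeSpace_sobolev (Q₁ : Set (E d)) : CompleteSpace (sobolev Q₁) := by
  have h : IsClosed (sobolev Q₁ : Set (Pair2 d)) :=
    (testSubmodule Q₁).isClosed_topologicalClosure.preimage (ContinuousLinearMap.continuous _)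
  exact h.completeSpace_coe

/-- The element of the Hilbert space of pairs with given components. -/
noncomputable def mkPair (u : L2Q d) (g : Fin d → L2Q d) : Pair2 d :=
  WithLp.toLp 2 (u, WithLp.toLp 2 g)

/-- Vanishing off Q₀ is a closed condition in L², so it passes from test functions to their closure.
-/
theorem fst_mem_L2soft {Q₁ : Set (E d)} {p : L2Q d × (Fin d → L2Q d)} (hp : p ∈ H10 Q₁) :
    p.1 ∈ L2soft Q₁ := by
  refine closure_minimal (t := Prod.fst ⁻¹' (L2soft Q₁ : Set (L2Q d))) ?_
    ((isClosed_vanishOn _).preimage continuous_fst) hp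
  rintro p ⟨φ, -, -, hφs, hp, -⟩
  change p.1 =ᵐ[(cellMeasure d).restrict (cell d \ soft Q₁)] 0
  filter_upwards [ae_restrict_of_ae hp,
    ae_restrict_mem ((measurableSet_cell d).diff (measurableSet_soft Q₁))] with x h1 h2
  rw [h1]
  exact image_eq_zero_of_notMem_tsupport fun h => h2.2 (hφs h)

theorem hasFDerivAt_expWave (κ y : E d) :
    HasFDerivAt (expWave κ)
      (expWave κ y • (Complex.I • (Complex.ofRealCLM ∘L innerSL ℝ κ))) y := by
  have h : HasFDerivAt (fun y : E d => Complex.I * ((inner ℝ κ y : ℝ) : ℂ))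
      (Complex.I • (Complex.ofRealCLM ∘L innerSL ℝ κ)) y :=
    (Complex.ofRealCLM ∘L innerSL ℝ κ).hasFDerivAt.const_mul Complex.I
  exact h.cexp

theorem contDiff_expWave (κ : E d) :
    ContDiff ℝ ((⊤ : ℕ∞) : WithTop ℕ∞) (expWave κ) := by
  have h : ContDiff ℝ ((⊤ : ℕ∞) : WithTop ℕ∞) (fun y : E d => ((inner ℝ κ y : ℝ) : ℂ)) :=
    (Complex.ofRealCLM ∘L innerSL ℝ κ).contDiff
  exact (contDiff_const.mul h).cexp

theorem coeFn_mulExp (κ : E d) (f : L2Q d) :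
    mulExp κ f =ᵐ[cellMeasure d] fun y => expWave κ y * f y :=
  (memLp_expWave_mul κ f).coeFn_toLp

/-- The phase is smooth, so it preserves C_c^∞(Q₀), and the product rule gives the term iκu. The map
on pairs is continuous, hence preserves the closure. -/
theorem mulExp_mem_H10 {Q₁ : Set (E d)} (κ : E d) {u : L2Q d} {g : Fin d → L2Q d}
    (h : (u, g) ∈ H10 Q₁) :
    (mulExp κ u, fun j => mulExp κ (g j) + (Complex.I * (κ j : ℂ)) • mulExp κ u) ∈ H10 Q₁ := by
  refine map_mem_closure (f := fun p : L2Q d × (Fin d → L2Q d) =>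
    ((mulExp κ p.1, fun j => mulExp κ (p.2 j) + (Complex.I * (κ j : ℂ)) • mulExp κ p.1) :
      L2Q d × (Fin d → L2Q d))) (by fun_prop) h ?_
  rintro p ⟨φ, hφ, hφc, hφs, hp, hp'⟩
  refine ⟨expWave κ * φ, (contDiff_expWave κ).mul hφ, hφc.mul_left, ?_, ?_, fun j => ?_⟩
  · exact (closure_mono (Function.support_mul_subset_right _ _)).trans hφs
  · filter_upwards [coeFn_mulExp κ p.1, hp] with x h1 h2
    rw [h1, h2]
    rfl
  · filter_upwards [Lp.coeFn_add (mulExp κ (p.2 j)) ((Complex.I * (κ j : ℂ)) • mulExp κ p.1),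
      Lp.coeFn_smul (Complex.I * (κ j : ℂ)) (mulExp κ p.1), coeFn_mulExp κ p.1,
      coeFn_mulExp κ (p.2 j), hp, hp' j] with x h1 h2 h3 h4 h5 h6
    have h7 := ((hasFDerivAt_expWave κ x).mul
      ((hφ.differentiable (by simp) x).hasFDerivAt)).fderiv
    change _ = fderiv ℝ (fun y => expWave κ y * φ y) x _
    rw [h1, Pi.add_apply, h2, Pi.smul_apply, h3, h4, h5, h6]
    change fderiv ℝ (expWave κ * φ) x = _ at h7
    change _ = fderiv ℝ (expWave κ * φ) x _
    rw [h7]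
    simp [EuclideanSpace.inner_single_right]
    ring

theorem mulExp_mem_L2soft {Q₁ : Set (E d)} (κ : E d) {u : L2Q d} (h : u ∈ L2soft Q₁) :
    mulExp κ u ∈ L2soft Q₁ := by
  have h' : u =ᵐ[(cellMeasure d).restrict (cell d \ soft Q₁)] 0 := h
  change mulExp κ u =ᵐ[(cellMeasure d).restrict (cell d \ soft Q₁)] 0
  filter_upwards [h', ae_restrict_of_ae (coeFn_mulExp κ u)] with x h1 h2
  rw [h2, h1]
  simp

theorem mulExp_neg_mulExp (κ : E d) (f : L2Q d) : mulExp (-κ) (mulExp κ f) = f := by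
  refine Lp.ext ?_
  filter_upwards [coeFn_mulExp (-κ) (mulExp κ f), coeFn_mulExp κ f] with x h1 h2
  rw [h1, h2, ← mul_assoc, expWave, expWave, ← Complex.exp_add]
  simp

theorem mulExp_mulExp_neg (κ : E d) (f : L2Q d) : mulExp κ (mulExp (-κ) f) = f := by
  simpa using mulExp_neg_mulExp (-κ) f

theorem inner_mulExp_mulExp (κ : E d) (f g : L2Q d) :
    inner ℂ (mulExp κ f) (mulExp κ g) = inner ℂ f g := by
  rw [L2.inner_def, L2.inner_def]
  refine integral_congr_ae ?_
  filter_upwards [coeFn_mulExp κ f, coeFn_mulExp κ g] with x h1 h2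
  rw [h1, h2]
  have h := congrArg (fun r : ℝ => (r : ℂ) ^ 2) (norm_expWave κ x)
  simp only [← Complex.mul_conj', Complex.ofReal_one, one_pow] at h
  simp only [RCLike.inner_apply, map_mul]
  linear_combination (g x * (starRingEnd ℂ) (f x)) * h

end Sobolev

/-! ### The geometry of the cell -/

section Geometry

variable {d : ℕ} {Q₁ : Set (E d)}

theorem soft_subset (Q₁ : Set (E d)) : soft Q₁ ⊆ cell d \ Q₁ := interior_subset

theorem IsStiffSet.subset_cell (hQ : IsStiffSet Q₁) : Q₁ ⊆ cell d := by
  obtain ⟨U, -, rfl⟩ := hQ.relOpen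
  exact Set.inter_subset_left

theorem IsStiffSet.measurableSet (hQ : IsStiffSet Q₁) : MeasurableSet Q₁ := by
  obtain ⟨U, hU, rfl⟩ := hQ.relOpen
  exact (measurableSet_cell d).inter hU.measurableSet

theorem IsStiffSet.ae_mem (hQ : IsStiffSet Q₁) :
    ∀ᵐ x ∂(cellMeasure d), x ∈ Q₁ ∨ x ∈ soft Q₁ := by
  have h : ∀ᵐ x, x ∉ cell d \ (Q₁ ∪ soft Q₁) := measure_eq_zero_iff_ae_notMem.1 hQ.fill
  rw [cellMeasure, ae_restrict_iff' (measurableSet_cell d)]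
  filter_upwards [h] with x hx hc
  by_contra hn
  exact hx ⟨hc, hn⟩

/-- By `fill`, Q₁ and Q \ Q₀ agree up to a null set. This reconciles 𝓛, defined through Q₁, with
L²(Q₀). -/
theorem IsStiffSet.vanishOn_eq (hQ : IsStiffSet Q₁) : vanishOn Q₁ = L2soft Q₁ := by
  have h : (Q₁ : Set (E d)) =ᵐ[cellMeasure d] (cell d \ soft Q₁ : Set (E d)) := by
    filter_upwards [hQ.ae_mem] with x hx
    refine propext ⟨fun h => ⟨hQ.subset_cell h, fun hs => (soft_subset Q₁ hs).2 h⟩, fun h => ?_⟩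
    exact hx.resolve_right h.2
  ext f
  change f =ᵐ[(cellMeasure d).restrict Q₁] 0 ↔
    f =ᵐ[(cellMeasure d).restrict (cell d \ soft Q₁)] 0
  rw [Measure.restrict_congr_set h]

theorem isBounded_cell (d : ℕ) : Bornology.IsBounded (cell d) := by
  refine (Metric.isBounded_iff_subset_closedBall (0 : E d)).2 ⟨Real.sqrt d, fun x hx => ?_⟩
  rw [mem_closedBall_zero_iff, EuclideanSpace.norm_eq]
  apply Real.sqrt_le_sqrt
  calc ∑ i, ‖x i‖ ^ 2 ≤ ∑ _i : Fin d, (1 : ℝ) := by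
        refine Finset.sum_le_sum fun i _ => ?_
        obtain ⟨h0, h1⟩ := hx i
        rw [Real.norm_eq_abs, sq_abs]
        nlinarith
    _ = d := by simp

/-- The soft component keeps a positive distance from the faces `x i = 0`. -/
theorem IsStiffSet.exists_margin (hQ : IsStiffSet Q₁) :
    ∃ δ : ℝ, 0 < δ ∧ δ < 1 ∧ ∀ x ∈ soft Q₁, ∀ i, δ ≤ x i := by
  have hK : IsCompact (closure (soft Q₁)) :=
    ((isBounded_cell d).subset ((soft_subset Q₁).trans Set.sdiff_subset)).isCompact_closure
  have h : ∀ i : Fin d, ∃ δ : ℝ, 0 < δ ∧ ∀ x ∈ soft Q₁, δ ≤ x i := by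
    intro i
    rcases (soft Q₁).eq_empty_or_nonempty with h0 | h0
    · exact ⟨1, one_pos, by simp [h0]⟩
    · obtain ⟨z, hz, hmin⟩ := hK.exists_isMinOn h0.closure
        (f := fun x : E d => x i) (by fun_prop)
      exact ⟨z i, (hQ.soft_inside hz i).1, fun x hx => hmin (subset_closure hx)⟩
  choose δ hδ hδ' using h
  obtain ⟨m, hm, hm'⟩ : ∃ m : ℝ, 0 < m ∧ ∀ i, m ≤ δ i := by
    rcases isEmpty_or_nonempty (Fin d) with he | he
    · exact ⟨1, one_pos, fun i => he.elim i⟩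
    · obtain ⟨i, hi⟩ := Finite.exists_min δ
      exact ⟨δ i, hδ i, hi⟩
  -- The bound 1/2 only ensures δ < 1, so that the box (0,δ)^d lies in the cell.
  exact ⟨min m (1 / 2), by positivity, (min_le_right _ _).trans_lt (by norm_num),
    fun x hx i => (min_le_left _ _).trans ((hm' i).trans (hδ' i x hx))⟩

theorem cellMeasure_box_pos {δ : ℝ} (h0 : 0 < δ) (h1 : δ < 1) :
    0 < cellMeasure d {x | ∀ i, x i ∈ Set.Ioo 0 δ} := by
  have hO : IsOpen {x : E d | ∀ i, x i ∈ Set.Ioo 0 δ} := by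
    simp only [Set.ofPred_forall]
    exact isOpen_iInter_of_finite fun i => isOpen_Ioo.preimage (f := fun x : E d => x i)
      (by fun_prop)
  have hn : {x : E d | ∀ i, x i ∈ Set.Ioo 0 δ}.Nonempty :=
    ⟨WithLp.toLp 2 fun _ => δ / 2, fun i => ⟨by simp; linarith, by simp; linarith⟩⟩
  have hs : {x : E d | ∀ i, x i ∈ Set.Ioo 0 δ} ⊆ cell d :=
    fun x hx i => ⟨(hx i).1.le, (hx i).2.trans h1⟩
  rw [cellMeasure, Measure.restrict_apply hO.measurableSet, Set.inter_eq_left.2 hs]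
  exact hO.measure_pos volume hn

/-- The corner box (0,δ)^d misses Q₀, on which every coordinate is at least δ. -/
theorem IsStiffSet.measure_diff_soft_ne_zero (hQ : IsStiffSet Q₁) :
    cellMeasure d (cell d \ soft Q₁) ≠ 0 := by
  obtain ⟨δ, h0, h1, hδ⟩ := hQ.exists_margin
  refine ((cellMeasure_box_pos h0 h1).trans_le (measure_mono fun x hx => ?_)).ne'
  refine ⟨fun i => ⟨(hx i).1.le, (hx i).2.trans h1⟩, fun hs => ?_⟩
  rcases hQ.dim with hd | he
  · exact absurd (hδ x hs ⟨0, by omega⟩) (not_le.2 (hx _).2)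
  · simp [he] at hs

end Geometry

/-! ### The identification of `ℂ × L²(Q₀)` with `𝓛` -/

section Identification

variable {d : ℕ} {Q₁ : Set (E d)}

/-- The map `(c, u) ↦ c + ũ` as a continuous linear map. -/
noncomputable def identL (Q₁ : Set (E d)) : (ℂ × L2soft Q₁) →L[ℂ] L2Q d :=
  (const d).coprod (L2soft Q₁).subtypeL

theorem coeFn_const (d : ℕ) (c : ℂ) : const d c =ᵐ[cellMeasure d] fun _ => c :=
  Lp.coeFn_const (p := 2) (μ := cellMeasure d) c

/-- Off Q₀, a set of positive measure, c + ũ equals c; so c + ũ = 0 forces c = 0. -/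
theorem identL_injective (hQ : IsStiffSet Q₁) : Function.Injective (identL Q₁) := by
  refine (injective_iff_map_eq_zero _).2 ?_
  rintro ⟨c, u, hu⟩ h
  have h' : const d c + u = 0 := h
  have hu' : u =ᵐ[(cellMeasure d).restrict (cell d \ soft Q₁)] 0 := hu
  have hc : c = 0 := by
    have hae : ∀ᵐ x ∂(cellMeasure d).restrict (cell d \ soft Q₁), c = 0 := by
      filter_upwards [hu', ae_restrict_of_ae (coeFn_const d c),
        ae_restrict_of_ae (Lp.coeFn_add (const d c) u),
        ae_restrict_of_ae (Lp.coeFn_zero ℂ 2 (cellMeasure d))] with x h1 h2 h3 h4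
      rw [h', h4, Pi.add_apply, h1, h2] at h3
      simpa using h3.symm
    have : NeZero ((cellMeasure d).restrict (cell d \ soft Q₁)) :=
      ⟨fun h => hQ.measure_diff_soft_ne_zero (Measure.restrict_eq_zero.1 h)⟩
    obtain ⟨x, hx⟩ := hae.exists
    exact hx
  subst hc
  simp only [map_zero, zero_add] at h'
  subst h'
  rfl

theorem identL_mem_calL (hQ : IsStiffSet Q₁) (p : ℂ × L2soft Q₁) : identL Q₁ p ∈ calL Q₁ := by
  refine Submodule.mem_sup.2 ⟨p.2, ?_, const d p.1, ⟨p.1, rfl⟩, add_comm _ _⟩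
  rw [hQ.vanishOn_eq]
  exact p.2.2

/-- A bounded bijection of Banach spaces, so the open mapping theorem makes the inverse continuous.
-/
theorem exists_identEquiv (hQ : IsStiffSet Q₁) :
    ∃ J : (ℂ × L2soft Q₁) ≃L[ℂ] calL Q₁, ∀ p, ((J p : calL Q₁) : L2Q d) = ident Q₁ p := by
  let F : (ℂ × L2soft Q₁) →L[ℂ] calL Q₁ := (identL Q₁).codRestrict (calL Q₁) (identL_mem_calL hQ)
  refine ⟨ContinuousLinearEquiv.ofBijective F ?_ ?_, fun p => rfl⟩
  · refine LinearMap.ker_eq_bot.2 fun a b hab => ?_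
    exact identL_injective hQ (congrArg Subtype.val hab)
  · refine LinearMap.range_eq_top.2 fun y => ?_
    obtain ⟨u, hu, w, ⟨c, hc⟩, h⟩ := Submodule.mem_sup.1 y.2
    rw [hQ.vanishOn_eq] at hu
    refine ⟨(c, ⟨u, hu⟩), Subtype.ext ?_⟩
    change const d c + u = y
    rw [← h, ← hc, add_comm]
    rfl

/-- Bounds |c| and ‖u‖ separately by ‖c + ũ‖, which makes the homogenised form plus the inner
product coercive on ℂ × H¹₀(Q₀). -/
theorem exists_norm_le_identL (hQ : IsStiffSet Q₁) :
    ∃ K : ℝ, 0 < K ∧ ∀ p : ℂ × L2soft Q₁, ‖p‖ ≤ K * ‖identL Q₁ p‖ := by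
  obtain ⟨J, hJ⟩ := exists_identEquiv hQ
  refine ⟨‖(J.symm : calL Q₁ →L[ℂ] (ℂ × L2soft Q₁))‖ + 1, by positivity, fun p => ?_⟩
  have h := (J.symm : calL Q₁ →L[ℂ] (ℂ × L2soft Q₁)).le_opNorm (J p)
  have h2 : ‖J p‖ = ‖identL Q₁ p‖ := by
    rw [Submodule.coe_norm, hJ]; rfl
  rw [h2] at h
  simp only [ContinuousLinearEquiv.coe_coe, ContinuousLinearEquiv.symm_apply_apply] at h
  nlinarith [norm_nonneg (identL Q₁ p)]

end Identification

/-! ### Existence of the resolvents -/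

section Resolvents

variable {d : ℕ} {Q₁ : Set (E d)} {A₀ A₁ : E d → Matrix (Fin d) (Fin d) ℝ} {ν : ℝ}

/-- The embedding of `H¹₀(Q₀)` into `L²(Q₀)`. -/
noncomputable def sobolevToL2 (Q₁ : Set (E d)) : sobolev Q₁ →L[ℂ] L2soft Q₁ :=
  (WithLp.fstL 2 ℂ (L2Q d) (Field2 d) ∘L (sobolev Q₁).subtypeL).codRestrict (L2soft Q₁)
    fun w => fst_mem_L2soft (mem_sobolev.1 w.2)

/-- The shifted gradient on `H¹₀(Q₀)`. -/
noncomputable def sobolevShift (Q₁ : Set (E d)) (κ : E d) : sobolev Q₁ →L[ℂ] Field2 d :=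
  shiftL κ ∘L (sobolev Q₁).subtypeL

/-- The bounded operator on `H¹₀(Q₀)` representing the form with coefficients `A₀`. -/
noncomputable def formOperator (Q₁ : Set (E d)) (hA₀ : IsCoefficient A₀) (κ : E d) :
    sobolev Q₁ →L[ℂ] sobolev Q₁ :=
  ContinuousLinearMap.adjoint (𝕜 := ℂ) (E := sobolev Q₁) (F := Field2 d) (sobolevShift Q₁ κ) ∘L
    mulMatrix hA₀ ∘L sobolevShift Q₁ κ

theorem inner_formOperator (hA₀ : IsCoefficient A₀) (κ : E d) (w v : sobolev Q₁) :
    inner ℂ w (formOperator Q₁ hA₀ κ v) =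
      inner ℂ (shiftL κ (w : Pair2 d)) (mulMatrix hA₀ (shiftL κ (v : Pair2 d))) := by
  rw [formOperator, ContinuousLinearMap.comp_apply, ContinuousLinearMap.adjoint_inner_right]
  rfl

theorem re_inner_formOperator_ge (hA₀ : IsCoefficient A₀) (h : EllipticOn A₀ ν (cell d))
    (κ : E d) (v : sobolev Q₁) :
    ν * ‖shiftL κ (v : Pair2 d)‖ ^ 2 ≤ (inner ℂ v (formOperator Q₁ hA₀ κ v)).re := by
  rw [inner_formOperator]
  exact re_inner_mulMatrix_ge hA₀ h _

theorem exists_isResolvent_B0 (hν : 0 < ν) (hA₀ : IsCoefficient A₀)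
    (h : EllipticOn A₀ ν (cell d)) :
    ∃ R : L2soft Q₁ →L[ℂ] L2soft Q₁, IsResolvent (B0 Q₁ A₀) R := by
  obtain ⟨c, hc, hcw⟩ := norm_sq_le_shiftL (0 : E d)
  obtain ⟨R, hR⟩ := exists_resolvent_of_coercive (V := sobolev Q₁)
    (formOperator Q₁ hA₀ 0) (sobolevToL2 Q₁) (L2soft Q₁).subtypeL (c := min ν 1 * c) (by positivity) (by
      intro v
      have h1 := re_inner_formOperator_ge hA₀ h 0 v
      have h2 := hcw v
      have h3 : ‖(L2soft Q₁).subtypeL (sobolevToL2 Q₁ v)‖ = ‖(v : Pair2 d).fst‖ := rfl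
      rw [h3, Submodule.coe_norm]
      calc min ν 1 * c * ‖(v : Pair2 d)‖ ^ 2
          ≤ min ν 1 * (‖shiftL 0 (v : Pair2 d)‖ ^ 2 + ‖(v : Pair2 d).fst‖ ^ 2) := by
            rw [mul_assoc]; gcongr
        _ ≤ ν * ‖shiftL 0 (v : Pair2 d)‖ ^ 2 + 1 * ‖(v : Pair2 d).fst‖ ^ 2 := by
            rw [mul_add]; gcongr <;> simp
        _ ≤ _ := by linarith)
  refine ⟨R, fun f x => (hR f x).trans ⟨?_, ?_⟩⟩
  · rintro ⟨v, rfl, hv⟩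
    refine ⟨fun j => (v : Pair2 d).snd j, v.2, fun w g hw => ?_⟩
    refine (hv ⟨mkPair w g, hw⟩).trans ?_
    rw [inner_formOperator, ← energy_shiftGrad]
    rfl
  · rintro ⟨g, hg, hv⟩
    refine ⟨⟨mkPair x g, hg⟩, Subtype.ext rfl, fun w => ?_⟩
    refine (hv (sobolevToL2 Q₁ w) (fun j => (w : Pair2 d).snd j) w.2).trans ?_
    rw [inner_formOperator, ← energy_shiftGrad]
    rfl

theorem exists_isResolvent_Bhom (hν : 0 < ν) (hQ : IsStiffSet Q₁) (hA₀ : IsCoefficient A₀)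
    (h : EllipticOn A₀ ν (cell d)) {ε : ℝ} {θ : E d} (hhom : 0 ≤ homForm A₁ θ) :
    ∃ R : (ℂ × L2soft Q₁) →L[ℂ] (ℂ × L2soft Q₁), IsResolvent (Bhom Q₁ A₀ A₁ ε θ) R := by
  obtain ⟨c, hc, hcw⟩ := norm_sq_le_shiftL (ε • θ)
  obtain ⟨K, hK, hKp⟩ := exists_norm_le_identL hQ
  obtain ⟨R, hR⟩ := exists_resolvent_of_coercive_prod (V := sobolev Q₁) (homForm A₁ θ)
    (formOperator Q₁ hA₀ (ε • θ)) (sobolevToL2 Q₁) (identL Q₁)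
    -- The factor 1/(2K²) comes from |z|² + ‖u‖² ≤ 2K²‖z + u‖². The homogenised term enters only
    -- through its sign, so the constant component is controlled by the inner product alone.
    (c := min ν (1 / (2 * K ^ 2)) * min c 1) (by positivity) (by
      intro z v
      have h1 := re_inner_formOperator_ge hA₀ h (ε • θ) v
      have h2 := hcw v
      set p : ℂ × L2soft Q₁ := (z, sobolevToL2 Q₁ v) with hp
      have hp1 : ‖z‖ ≤ K * ‖identL Q₁ p‖ := (norm_fst_le p).trans (hKp p)
      have hp2 : ‖(v : Pair2 d).fst‖ ≤ K * ‖identL Q₁ p‖ := (norm_snd_le p).trans (hKp p)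
      have h3 : 1 / (2 * K ^ 2) * (‖z‖ ^ 2 + ‖(v : Pair2 d).fst‖ ^ 2) ≤
          ‖identL Q₁ p‖ ^ 2 := by
        rw [one_div, inv_mul_le_iff₀ (by positivity)]
        have := pow_le_pow_left₀ (norm_nonneg _) hp1 2
        have := pow_le_pow_left₀ (norm_nonneg _) hp2 2
        nlinarith
      have h5 : 0 ≤ homForm A₁ θ * ‖z‖ ^ 2 := by positivity
      have h6 : min c 1 * (‖z‖ ^ 2 + ‖v‖ ^ 2) ≤ ‖z‖ ^ 2 +
          (‖shiftL (ε • θ) (v : Pair2 d)‖ ^ 2 + ‖(v : Pair2 d).fst‖ ^ 2) := by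
        rw [mul_add]
        refine add_le_add ?_ (le_trans ?_ h2)
        · exact mul_le_of_le_one_left (by positivity) (min_le_right _ _)
        · rw [Submodule.coe_norm]
          exact mul_le_mul_of_nonneg_right (min_le_left _ _) (by positivity)
      set m := min ν (1 / (2 * K ^ 2)) with hm
      have hm0 : 0 ≤ m := by positivity
      calc m * min c 1 * (‖z‖ ^ 2 + ‖v‖ ^ 2) ≤ m * (‖z‖ ^ 2 +
          (‖shiftL (ε • θ) (v : Pair2 d)‖ ^ 2 + ‖(v : Pair2 d).fst‖ ^ 2)) := by
            rw [mul_assoc]; gcongr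
        _ = m * ‖shiftL (ε • θ) (v : Pair2 d)‖ ^ 2 +
            m * (‖z‖ ^ 2 + ‖(v : Pair2 d).fst‖ ^ 2) := by ring
        _ ≤ ν * ‖shiftL (ε • θ) (v : Pair2 d)‖ ^ 2 +
            1 / (2 * K ^ 2) * (‖z‖ ^ 2 + ‖(v : Pair2 d).fst‖ ^ 2) := by
            gcongr
            · exact min_le_left _ _
            · exact min_le_right _ _
        _ ≤ _ := by linarith)
  refine ⟨R, fun f x => (hR f x).trans ⟨?_, ?_⟩⟩
  · rintro ⟨v, hv, hv'⟩
    refine ⟨fun j => (v : Pair2 d).snd j, ?_, fun e w g hw => ?_⟩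
    · rw [← hv]
      exact v.2
    · refine (hv' e ⟨mkPair w g, hw⟩).trans ?_
      rw [inner_formOperator, ← energy_shiftGrad, ← hv]
      rfl
  · rintro ⟨g, hg, hv⟩
    refine ⟨⟨mkPair x.2 g, hg⟩, Subtype.ext rfl, fun e w => ?_⟩
    refine (hv e (sobolevToL2 Q₁ w) (fun j => (w : Pair2 d).snd j) w.2).trans ?_
    rw [inner_formOperator, ← energy_shiftGrad]
    rfl

end Resolvents

/-! ### A lower bound for the homogenised form -/

section LowerBound

open Filter Topology

variable {d : ℕ}

/-- A smooth bump function with values in `[0,1]`, positive exactly on `(0,δ)`. -/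
noncomputable def bump (δ t : ℝ) : ℝ := Real.smoothTransition t * Real.smoothTransition (δ - t)

theorem bump_nonneg (δ t : ℝ) : 0 ≤ bump δ t :=
  mul_nonneg (Real.smoothTransition.nonneg _) (Real.smoothTransition.nonneg _)

theorem bump_le_one (δ t : ℝ) : bump δ t ≤ 1 :=
  mul_le_one₀ (Real.smoothTransition.le_one _) (Real.smoothTransition.nonneg _)
    (Real.smoothTransition.le_one _)

theorem bump_ne_zero_iff {δ t : ℝ} : bump δ t ≠ 0 ↔ t ∈ Set.Ioo 0 δ := by
  simp [bump, Real.smoothTransition.zero_iff_nonpos]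

theorem contDiff_bump (δ : ℝ) : ContDiff ℝ ((⊤ : ℕ∞) : WithTop ℕ∞) (bump δ) :=
  Real.smoothTransition.contDiff.mul
    (Real.smoothTransition.contDiff.comp (contDiff_const.sub contDiff_id))

/-- A smooth cutoff independent of the coordinate `x i`, with all other coordinates in `(0,δ)`. -/
noncomputable def crossCutoff (δ : ℝ) (i : Fin d) (x : E d) : ℝ :=
  ∏ k ∈ Finset.univ.erase i, bump δ (x k)

theorem crossCutoff_nonneg (δ : ℝ) (i : Fin d) (x : E d) : 0 ≤ crossCutoff δ i x :=
  Finset.prod_nonneg fun _ _ => bump_nonneg _ _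

theorem crossCutoff_le_one (δ : ℝ) (i : Fin d) (x : E d) : crossCutoff δ i x ≤ 1 :=
  Finset.prod_le_one (fun _ _ => bump_nonneg _ _) fun _ _ => bump_le_one _ _

theorem crossCutoff_ne_zero_iff {δ : ℝ} {i : Fin d} {x : E d} :
    crossCutoff δ i x ≠ 0 ↔ ∀ k, k ≠ i → x k ∈ Set.Ioo 0 δ := by
  simp only [crossCutoff, Finset.prod_ne_zero_iff, Finset.mem_erase, Finset.mem_univ, and_true,
    bump_ne_zero_iff]

theorem contDiff_crossCutoff (δ : ℝ) (i : Fin d) :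
    ContDiff ℝ ((⊤ : ℕ∞) : WithTop ℕ∞) (crossCutoff δ i) := by
  unfold crossCutoff
  exact contDiff_prod fun k _ => (contDiff_bump δ).comp
    (EuclideanSpace.proj (𝕜 := ℝ) k : E d →L[ℝ] ℝ).contDiff

theorem crossCutoff_add_smul_single (δ : ℝ) (i : Fin d) (x : E d) (t : ℝ) :
    crossCutoff δ i (x + t • EuclideanSpace.single i 1) = crossCutoff δ i x := by
  refine Finset.prod_congr rfl fun k hk => ?_
  simp [Finset.ne_of_mem_erase hk]

theorem contDiff_profile_mul {h : ℝ → ℝ} (hh : ContDiff ℝ ((⊤ : ℕ∞) : WithTop ℕ∞) h) (δ : ℝ)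
    (i : Fin d) : ContDiff ℝ ((⊤ : ℕ∞) : WithTop ℕ∞)
      (fun x : E d => ((h (x i) * crossCutoff δ i x : ℝ) : ℂ)) :=
  Complex.ofRealCLM.contDiff.comp
    ((hh.comp (EuclideanSpace.proj (𝕜 := ℝ) i : E d →L[ℝ] ℝ).contDiff).mul
      (contDiff_crossCutoff δ i))

theorem fderiv_profile_mul {h : ℝ → ℝ} (hh : ContDiff ℝ ((⊤ : ℕ∞) : WithTop ℕ∞) h) (δ : ℝ)
    (i : Fin d) (x : E d) :
    fderiv ℝ (fun x : E d => ((h (x i) * crossCutoff δ i x : ℝ) : ℂ)) x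
      (EuclideanSpace.single i 1) = ((deriv h (x i) * crossCutoff δ i x : ℝ) : ℂ) := by
  rw [← ((contDiff_profile_mul hh δ i).differentiable (by simp) x).lineDeriv_eq_fderiv, lineDeriv]
  simp only [crossCutoff_add_smul_single]
  have h1 : HasDerivAt h (deriv h (x i)) (x i + 0) := by
    rw [add_zero]; exact (hh.differentiable (by simp) _).hasDerivAt
  have h2 := ((h1.comp_const_add (x i) 0).mul_const (crossCutoff δ i x)).ofReal_comp
  simpa using h2.deriv

/-- A smooth step from `0` to `1` on `[-1/(n+1), 0]`. -/
noncomputable def step (n : ℕ) (t : ℝ) : ℝ := Real.smoothTransition ((n + 1) * t + 1)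

theorem contDiff_step (n : ℕ) : ContDiff ℝ ((⊤ : ℕ∞) : WithTop ℕ∞) (step n) :=
  Real.smoothTransition.contDiff.comp ((contDiff_const.mul contDiff_id).add contDiff_const)

theorem step_eq_one (n : ℕ) {t : ℝ} (ht : 0 ≤ t) : step n t = 1 :=
  Real.smoothTransition.one_of_one_le (by nlinarith [(n.cast_nonneg : (0 : ℝ) ≤ n)])

theorem step_eq_zero (n : ℕ) {t : ℝ} (ht : t ≤ -1) : step n t = 0 :=
  Real.smoothTransition.zero_of_nonpos (by nlinarith [(n.cast_nonneg : (0 : ℝ) ≤ n)])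

theorem deriv_step_eq_zero (n : ℕ) {t : ℝ} (ht : t ∉ Set.Icc (-1 : ℝ) 0) :
    deriv (step n) t = 0 := by
  rcases lt_or_ge t (-1) with h | h
  · have : step n =ᶠ[𝓝 t] fun _ => (0 : ℝ) := by
      filter_upwards [Iio_mem_nhds h] with s hs using step_eq_zero n (le_of_lt hs)
    rw [this.deriv_eq, deriv_const]
  · have h' : 0 < t := not_le.1 fun h0 => ht ⟨h, h0⟩
    have : step n =ᶠ[𝓝 t] fun _ => (1 : ℝ) := by
      filter_upwards [Ioi_mem_nhds h'] with s hs using step_eq_one n (le_of_lt hs)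
    rw [this.deriv_eq, deriv_const]

/-- The sequence is eventually constant at each point; as the step already equals 1 at 0, the limit
is the indicator of the closed half-line. -/
theorem tendsto_step (t : ℝ) :
    Tendsto (fun n => step n t) atTop (𝓝 (if 0 ≤ t then 1 else 0)) := by
  refine tendsto_const_nhds.congr' ?_
  split_ifs with h
  · exact Eventually.of_forall fun n => (step_eq_one n h).symm
  · have h' : 0 < -t := by linarith [not_le.1 h]
    obtain ⟨N, hN⟩ := exists_nat_gt (1 / -t)
    filter_upwards [eventually_ge_atTop N] with n hn
    refine (Real.smoothTransition.zero_of_nonpos ?_).symm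
    rw [div_lt_iff₀ h'] at hN
    have : (N : ℝ) ≤ n := by exact_mod_cast hn
    nlinarith

/-- A smooth approximation of the indicator function of `[0,1)`. -/
noncomputable def plateau (n : ℕ) (t : ℝ) : ℝ := step n t - step n (t - 1)

theorem contDiff_plateau (n : ℕ) : ContDiff ℝ ((⊤ : ℕ∞) : WithTop ℕ∞) (plateau n) :=
  (contDiff_step n).sub ((contDiff_step n).comp (contDiff_id.sub contDiff_const))

theorem deriv_plateau (n : ℕ) (t : ℝ) :
    deriv (plateau n) t = deriv (step n) t - deriv (step n) (t - 1) := by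
  have h : Differentiable ℝ (step n) := (contDiff_step n).differentiable (by simp)
  exact ((h t).hasDerivAt.sub ((h (t - 1)).hasDerivAt.comp_sub_const t 1)).deriv

theorem abs_plateau_le (n : ℕ) (t : ℝ) : |plateau n t| ≤ 1 := by
  have h1 : 0 ≤ step n t := Real.smoothTransition.nonneg _
  have h2 : 0 ≤ step n (t - 1) := Real.smoothTransition.nonneg _
  have h3 : step n t ≤ 1 := Real.smoothTransition.le_one _
  have h4 : step n (t - 1) ≤ 1 := Real.smoothTransition.le_one _
  rw [plateau, abs_le]
  constructor <;> linarith

theorem plateau_eq_zero (n : ℕ) {t : ℝ} (ht : t ∉ Set.Icc (-1 : ℝ) 1) : plateau n t = 0 := by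
  rcases lt_or_ge t (-1) with h | h
  · rw [plateau, step_eq_zero n h.le, step_eq_zero n (by linarith), sub_zero]
  · have h' : 1 < t := not_le.1 fun h0 => ht ⟨h, h0⟩
    rw [plateau, step_eq_one n (by linarith), step_eq_one n (by linarith), sub_self]

theorem tendsto_plateau (t : ℝ) :
    Tendsto (fun n => plateau n t) atTop (𝓝 (if t ∈ Set.Ico 0 1 then 1 else 0)) := by
  have h := (tendsto_step t).sub (tendsto_step (t - 1))
  suffices h' : (if t ∈ Set.Ico (0 : ℝ) 1 then (1 : ℝ) else 0) =
      (if 0 ≤ t then 1 else 0) - if 0 ≤ t - 1 then 1 else 0 by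
    rw [h']
    exact h
  simp only [Set.mem_Ico, sub_nonneg]
  by_cases h0 : 0 ≤ t <;> by_cases h1 : t < 1
  · simp [h0, h1, not_le.2 h1]
  · simp [h0, h1, not_lt.1 h1]
  · simp [h0, not_le.2 h1]
  · linarith [not_lt.1 h1, not_le.1 h0]

/-- The cube `[-1,1]^d`. -/
def cube (d : ℕ) : Set (E d) := {x | ∀ i, x i ∈ Set.Icc (-1 : ℝ) 1}

theorem isCompact_cube (d : ℕ) : IsCompact (cube d) := by
  have h : cube d = WithLp.toLp 2 '' (Set.univ.pi fun _ : Fin d => Set.Icc (-1 : ℝ) 1) := by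
    ext x
    refine ⟨fun hx => ⟨WithLp.ofLp x, fun i _ => hx i, rfl⟩, ?_⟩
    rintro ⟨y, hy, rfl⟩ i
    exact hy i trivial
  rw [h]
  exact (isCompact_univ_pi fun _ => isCompact_Icc).image (PiLp.continuous_toLp 2 _)

theorem cell_subset_cube (d : ℕ) : cell d ⊆ cube d :=
  fun _ hx i => ⟨by linarith [(hx i).1], (hx i).2.le⟩

theorem profile_mul_eq_zero {h : ℝ → ℝ} (hh : ∀ t, t ∉ Set.Icc (-1 : ℝ) 1 → h t = 0) {δ : ℝ}
    (hδ : δ < 1) (i : Fin d) {x : E d} (hx : x ∉ cube d) : h (x i) * crossCutoff δ i x = 0 := by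
  by_contra hne
  obtain ⟨h1, h2⟩ := mul_ne_zero_iff.1 hne
  refine hx fun k => ?_
  rcases eq_or_ne k i with rfl | hk
  · by_contra hn
    exact h1 (hh _ hn)
  · obtain ⟨h3, h4⟩ := crossCutoff_ne_zero_iff.1 h2 k hk
    exact ⟨by linarith, by linarith⟩

theorem hasCompactSupport_profile_mul {h : ℝ → ℝ}
    (hh : ∀ t, t ∉ Set.Icc (-1 : ℝ) 1 → h t = 0) {δ : ℝ} (hδ : δ < 1) (i : Fin d) :
    HasCompactSupport (fun x : E d => ((h (x i) * crossCutoff δ i x : ℝ) : ℂ)) :=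
  HasCompactSupport.intro (isCompact_cube d) fun x hx => by
    rw [profile_mul_eq_zero hh hδ i hx, Complex.ofReal_zero]

theorem locallyIntegrable_of_memLp_compact {f : E d → ℂ}
    (hf : ∀ K : Set (E d), IsCompact K → MemLp f 2 (volume.restrict K)) :
    LocallyIntegrable f volume := by
  refine locallyIntegrable_iff.2 fun K hK => ?_
  have : IsFiniteMeasure (volume.restrict K) := ⟨by simpa using hK.measure_lt_top⟩
  exact (hf K hK).integrable (by norm_num)

/-- The derivative of the plateau is a function minus its unit translate. As u is periodic and the
cutoff ignores xᵢ, u times it has the form G(x) − G(x − eᵢ), whose integral vanishes by translation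
invariance. The step is not compactly supported, but its derivative is, so G is integrable. -/
theorem integral_grad_mul_plateau {u : E d → ℂ} {g : Fin d → E d → ℂ} (hu : IsPeriodicH1 u g)
    {δ : ℝ} (hδ : δ < 1) (i : Fin d) (n : ℕ) :
    ∫ x, g i x * ((plateau n (x i) * crossCutoff δ i x : ℝ) : ℂ) = 0 := by
  have h := hu.weak_grad i _ (contDiff_profile_mul (contDiff_plateau n) δ i)
    (hasCompactSupport_profile_mul (fun t => plateau_eq_zero n) hδ i)
  simp only [fderiv_profile_mul (contDiff_plateau n)] at h
  set G : E d → ℂ := fun x => u x * ((deriv (step n) (x i) * crossCutoff δ i x : ℝ) : ℂ) with hG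
  have hsupp : HasCompactSupport
      (fun x : E d => ((deriv (step n) (x i) * crossCutoff δ i x : ℝ) : ℂ)) :=
    hasCompactSupport_profile_mul (fun t ht => deriv_step_eq_zero n fun h' =>
      ht ⟨h'.1, h'.2.trans zero_le_one⟩) hδ i
  have hcont : Continuous
      (fun x : E d => ((deriv (step n) (x i) * crossCutoff δ i x : ℝ) : ℂ)) := by
    have h1 : Continuous (deriv (step n)) := (contDiff_step n).continuous_deriv (by simp)
    have h2 : Continuous (crossCutoff δ i) := (contDiff_crossCutoff δ i).continuous
    fun_prop
  have hGi : Integrable G :=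
    (locallyIntegrable_of_memLp_compact hu.memLp).integrable_smul_right_of_hasCompactSupport
      hcont hsupp
  have hshift : ∀ x, u x * ((deriv (plateau n) (x i) * crossCutoff δ i x : ℝ) : ℂ) =
      G x - G (x - EuclideanSpace.single i 1) := by
    intro x
    have h1 : u (x - EuclideanSpace.single i 1) = u x := by
      conv_rhs => rw [← sub_add_cancel x (EuclideanSpace.single i 1), hu.periodic]
    have h2 : crossCutoff δ i (x - EuclideanSpace.single i 1) = crossCutoff δ i x := by
      have := crossCutoff_add_smul_single δ i x (-1)
      rwa [neg_one_smul, ← sub_eq_add_neg] at this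
    simp only [hG, h1, h2, deriv_plateau]
    simp
    ring
  have h0 : ∫ x, u x * ((deriv (plateau n) (x i) * crossCutoff δ i x : ℝ) : ℂ) = 0 := by
    simp only [hshift]
    rw [integral_sub hGi (hGi.comp_sub_right _), integral_sub_right_eq_self, sub_self]
  rw [h0] at h
  exact neg_eq_zero.1 h.symm

/-- The gradient of a periodic function has mean zero along lines, tested against a cutoff that
does not depend on the coordinate along these lines. -/
theorem integral_grad_mul_crossCutoff {u : E d → ℂ} {g : Fin d → E d → ℂ}
    (hu : IsPeriodicH1 u g) {δ : ℝ} (hδ : δ < 1) (i : Fin d) :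
    ∫ x, g i x * (crossCutoff δ i x : ℂ) ∂(cellMeasure d) = 0 := by
  have hloc := locallyIntegrable_of_memLp_compact (hu.grad_memLp i)
  have hint : Integrable ((cube d).indicator fun x => ‖g i x‖) :=
    IntegrableOn.integrable_indicator
      (Integrable.norm (hloc.integrableOn_isCompact (isCompact_cube d)))
      (isCompact_cube d).measurableSet
  have hcont : Continuous (crossCutoff δ i) := (contDiff_crossCutoff δ i).continuous
  -- The plateaus tend to the indicator of [0,1) in xᵢ, with |gᵢ| on the fixed cube as majorant.
  have hlim := tendsto_integral_of_dominated_convergence (μ := (volume : Measure (E d)))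
    (F := fun n x => g i x * ((plateau n (x i) * crossCutoff δ i x : ℝ) : ℂ))
    (f := (cell d).indicator fun x => g i x * (crossCutoff δ i x : ℂ))
    ((cube d).indicator fun x => ‖g i x‖) ?_ hint ?_ ?_
  · simp only [integral_grad_mul_plateau hu hδ] at hlim
    rw [cellMeasure, ← integral_indicator (measurableSet_cell d)]
    exact (tendsto_nhds_unique tendsto_const_nhds hlim).symm
  · intro n
    have h1 : Continuous (plateau n) := (contDiff_plateau n).continuous
    refine hloc.aestronglyMeasurable.mul (Continuous.aestronglyMeasurable ?_)
    fun_prop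
  · refine fun n => Eventually.of_forall fun x => ?_
    by_cases hx : x ∈ cube d
    · rw [Set.indicator_of_mem hx, norm_mul, Complex.norm_real, norm_mul]
      refine mul_le_of_le_one_right (norm_nonneg _) (mul_le_one₀ (abs_plateau_le n _)
        (norm_nonneg _) ?_)
      rw [Real.norm_of_nonneg (crossCutoff_nonneg δ i x)]
      exact crossCutoff_le_one δ i x
    · rw [profile_mul_eq_zero (fun t => plateau_eq_zero n) hδ i hx, Set.indicator_of_notMem hx]
      simp
  · refine Eventually.of_forall fun x => ?_
    have h1 : Tendsto (fun n => g i x * ((plateau n (x i) * crossCutoff δ i x : ℝ) : ℂ)) atTop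
        (𝓝 (g i x * (((if x i ∈ Set.Ico 0 1 then 1 else 0) * crossCutoff δ i x : ℝ) : ℂ))) :=
      ((Complex.continuous_ofReal.tendsto _).comp
        ((tendsto_plateau (x i)).mul_const (crossCutoff δ i x))).const_mul (g i x)
    suffices h2 : (cell d).indicator (fun x => g i x * (crossCutoff δ i x : ℂ)) x =
        g i x * (((if x i ∈ Set.Ico 0 1 then 1 else 0) * crossCutoff δ i x : ℝ) : ℂ) by
      rw [h2]
      exact h1
    -- Where the cutoff is nonzero the other coordinates lie in (0,δ), so membership in the cell is
    -- decided by xᵢ alone.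
    by_cases hη : crossCutoff δ i x = 0
    · simp [hη, Set.indicator]
    · have h2 := crossCutoff_ne_zero_iff.1 hη
      by_cases hi : x i ∈ Set.Ico (0 : ℝ) 1
      · have hc : x ∈ cell d := by
          intro k
          rcases eq_or_ne k i with rfl | hk
          · exact hi
          · exact ⟨(h2 k hk).1.le, (h2 k hk).2.trans hδ⟩
        rw [Set.indicator_of_mem hc, if_pos hi, one_mul]
      · rw [Set.indicator_of_notMem (s := cell d) fun hc => hi (hc i), if_neg hi]
        simp

theorem IsPeriodicH1.memLp_const_add {u : E d → ℂ} {g : Fin d → E d → ℂ}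
    (hu : IsPeriodicH1 u g) (c : ℂ) (j : Fin d) :
    MemLp (fun x => c + g j x) 2 (cellMeasure d) :=
  (memLp_const c).add ((hu.grad_memLp j _ (isCompact_cube d)).mono_measure
    (Measure.restrict_mono (cell_subset_cube d) le_rfl))

variable {Q₁ : Set (E d)} {A₁ : E d → Matrix (Fin d) (Fin d) ℝ} {ν : ℝ}

/-- On Q₁ the energy density is at least ν(ξᵢ + Re gᵢ)², which dominates ν(ξᵢ²η + 2ξᵢ η Re gᵢ); on
Q₀ both the cutoff η and A₁ vanish. The linear term integrates to zero, leaving m = ν∫η. -/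
theorem exists_component_le_energy (hν : 0 < ν) (hQ : IsStiffSet Q₁) (hA₁ : IsCoefficient A₁)
    (hA₁_ell : EllipticOn A₁ ν Q₁) (hA₁_soft : ∀ᵐ x ∂(volume.restrict (soft Q₁)), A₁ x = 0)
    (i : Fin d) :
    ∃ m : ℝ, 0 < m ∧ ∀ (ξ : E d) (u : E d → ℂ) (g : Fin d → E d → ℂ), IsPeriodicH1 u g →
      m * ξ i ^ 2 ≤
        (energy A₁ (fun j x => (ξ j : ℂ) + g j x) (fun j x => (ξ j : ℂ) + g j x)).re := by
  obtain ⟨δ, h0, h1, hδ⟩ := hQ.exists_margin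
  have hcont : Continuous (crossCutoff δ i) := (contDiff_crossCutoff δ i).continuous
  have hηi : Integrable (crossCutoff δ i) (cellMeasure d) := by
    refine Integrable.of_bound hcont.aestronglyMeasurable 1 (Eventually.of_forall fun x => ?_)
    rw [Real.norm_of_nonneg (crossCutoff_nonneg δ i x)]
    exact crossCutoff_le_one δ i x
  have hη0 : ∀ x ∈ soft Q₁, crossCutoff δ i x = 0 := by
    intro x hx
    by_contra hne
    rcases hQ.dim with hd | he
    -- Here d ≥ 2 is essential: a second coordinate is needed to move the tube away from Q₀.
    · obtain ⟨k, hk⟩ : ∃ k : Fin d, k ≠ i :=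
        have : Nontrivial (Fin d) := Fin.nontrivial_iff_two_le.2 hd
        exists_ne i
      exact absurd (hδ x hx k) (not_le.2 (crossCutoff_ne_zero_iff.1 hne k hk).2)
    · simp [he] at hx
  have hm : 0 < ∫ x, crossCutoff δ i x ∂(cellMeasure d) := by
    rw [integral_pos_iff_support_of_nonneg (crossCutoff_nonneg δ i) hηi]
    refine (cellMeasure_box_pos h0 h1).trans_le (measure_mono fun x hx => ?_)
    exact crossCutoff_ne_zero_iff.2 fun k _ => hx k
  have hell : ∀ᵐ x ∂(cellMeasure d), x ∈ Q₁ → ∀ ξ : Fin d → ℝ,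
      ν * ∑ i, ξ i ^ 2 ≤ ∑ i, ∑ j, A₁ x i j * ξ j * ξ i :=
    ae_restrict_of_ae ((ae_restrict_iff' hQ.measurableSet).1 hA₁_ell)
  have hsoft : ∀ᵐ x ∂(cellMeasure d), x ∈ soft Q₁ → A₁ x = 0 :=
    ae_restrict_of_ae ((ae_restrict_iff' (measurableSet_soft Q₁)).1 hA₁_soft)
  refine ⟨ν * ∫ x, crossCutoff δ i x ∂(cellMeasure d), by positivity, fun ξ u g hu => ?_⟩
  have hg : MemLp (g i) 2 (cellMeasure d) := by simpa using hu.memLp_const_add 0 i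
  have hgη : Integrable (fun x => g i x * (crossCutoff δ i x : ℂ)) (cellMeasure d) := by
    refine (hg.integrable (by norm_num)).mul_bdd (c := 1)
      (by fun_prop) (Eventually.of_forall fun x => ?_)
    rw [Complex.norm_real, Real.norm_of_nonneg (crossCutoff_nonneg δ i x)]
    exact crossCutoff_le_one δ i x
  have hre : Integrable (fun x => (g i x * (crossCutoff δ i x : ℂ)).re) (cellMeasure d) := hgη.re
  have hre0 : ∫ x, (g i x * (crossCutoff δ i x : ℂ)).re ∂(cellMeasure d) = 0 := by
    have := integral_re hgη
    rw [integral_grad_mul_crossCutoff hu h1 i] at this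
    exact this
  have hF : Integrable (fun x => ν * (ξ i ^ 2 * crossCutoff δ i x +
      2 * ξ i * (g i x * (crossCutoff δ i x : ℂ)).re)) (cellMeasure d) :=
    ((hηi.const_mul _).add (hre.const_mul _)).const_mul _
  have hFint : ∫ x, ν * (ξ i ^ 2 * crossCutoff δ i x +
      2 * ξ i * (g i x * (crossCutoff δ i x : ℂ)).re) ∂(cellMeasure d) =
      ν * (∫ x, crossCutoff δ i x ∂(cellMeasure d)) * ξ i ^ 2 := by
    rw [integral_const_mul, integral_add (hηi.const_mul _) (hre.const_mul _),
      integral_const_mul, integral_const_mul, hre0]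
    ring
  rw [← hFint]
  refine le_re_energy hA₁ (fun j => hu.memLp_const_add _ j) hF ?_
  filter_upwards [hell, hsoft, hQ.ae_mem] with x h2 h3 h4
  rcases h4 with h4 | h4
  · refine le_trans ?_ (re_quadratic_ge (h2 h4) _)
    refine mul_le_mul_of_nonneg_left ?_ hν.le
    have h5 : ‖(ξ i : ℂ) + g i x‖ ^ 2 ≤ ∑ j, ‖(ξ j : ℂ) + g j x‖ ^ 2 :=
      Finset.single_le_sum (f := fun j => ‖(ξ j : ℂ) + g j x‖ ^ 2)
        (fun j _ => by positivity) (Finset.mem_univ i)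
    refine le_trans ?_ h5
    rw [Complex.sq_norm, Complex.normSq_apply]
    simp only [Complex.re_mul_ofReal, Complex.add_re, Complex.ofReal_re, Complex.add_im,
      Complex.ofReal_im, zero_add]
    have h6 := crossCutoff_nonneg δ i x
    have h7 := crossCutoff_le_one δ i x
    -- Expand (ξᵢ + Re gᵢ − ξᵢη)² ≥ 0 and use η² ≤ η.
    nlinarith [sq_nonneg (ξ i + (g i x).re - ξ i * crossCutoff δ i x), sq_nonneg (g i x).im,
      mul_nonneg (sq_nonneg (ξ i)) (mul_nonneg h6 (sub_nonneg.2 h7))]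
  · simp [hη0 x h4, h3 h4]

theorem exists_le_homForm (hν : 0 < ν) (hQ : IsStiffSet Q₁) (hA₁ : IsCoefficient A₁)
    (hA₁_ell : EllipticOn A₁ ν Q₁) (hA₁_soft : ∀ᵐ x ∂(volume.restrict (soft Q₁)), A₁ x = 0) :
    ∃ c : ℝ, 0 < c ∧ ∀ ξ : E d, c * ‖ξ‖ ^ 2 ≤ homForm A₁ ξ := by
  choose m hm hm' using exists_component_le_energy hν hQ hA₁ hA₁_ell hA₁_soft
  obtain ⟨c, hc, hc'⟩ : ∃ c : ℝ, 0 < c ∧ ∀ i, c ≤ m i := by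
    rcases isEmpty_or_nonempty (Fin d) with he | he
    · exact ⟨1, one_pos, fun i => he.elim i⟩
    · obtain ⟨i, hi⟩ := Finite.exists_min m
      exact ⟨m i, hm i, hi⟩
  -- Summing the d componentwise bounds costs a factor d; d + 1 avoids division by zero.
  refine ⟨c / (d + 1), by positivity, fun ξ => le_csInf ?_ ?_⟩
  -- The competitor u = 0: a lower bound passes to `sInf` only for a nonempty set.
  · refine ⟨_, 0, 0, ⟨fun _ _ => rfl, fun _ _ => MemLp.zero, fun _ _ _ => MemLp.zero, ?_⟩, rfl⟩
    intro j φ _ _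
    simp
  · rintro r ⟨u, g, hu, rfl⟩
    set r := (energy A₁ (fun j x => (ξ j : ℂ) + g j x) (fun j x => (ξ j : ℂ) + g j x)).re
    have h1 : ∀ i, c * ξ i ^ 2 ≤ r := fun i =>
      (mul_le_mul_of_nonneg_right (hc' i) (sq_nonneg _)).trans (hm' i ξ u g hu)
    have hr : 0 ≤ r := by
      have := le_re_energy (p := fun j x => (ξ j : ℂ) + g j x) hA₁ (F := fun _ => 0)
        (fun j => hu.memLp_const_add _ j) (integrable_zero _ _ _) ?_
      · simpa using this
      · filter_upwards [hQ.ae_mem,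
          ae_restrict_of_ae ((ae_restrict_iff' hQ.measurableSet).1 hA₁_ell),
          ae_restrict_of_ae ((ae_restrict_iff' (measurableSet_soft Q₁)).1 hA₁_soft)]
          with x h2 h3 h4
        rcases h2 with h2 | h2
        · exact le_trans (by positivity) (re_quadratic_ge (h3 h2) _)
        · simp [h4 h2]
    rw [EuclideanSpace.real_norm_sq_eq, div_mul_eq_mul_div, div_le_iff₀ (by positivity),
      Finset.mul_sum]
    calc ∑ i, c * ξ i ^ 2 ≤ ∑ _i : Fin d, r := Finset.sum_le_sum fun i _ => h1 i
      _ ≤ r * (d + 1) := by simp; nlinarith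

end LowerBound

/-! ### Comparison of the resolvents -/

section Comparison

variable {d : ℕ} {Q₁ : Set (E d)} {A₀ : E d → Matrix (Fin d) (Fin d) ℝ} {ν : ℝ}

/-- Multiplication of a function and its gradient by the phase `e^{iκ·y}`. -/
noncomputable def phase (κ : E d) (p : L2Q d × (Fin d → L2Q d)) : L2Q d × (Fin d → L2Q d) :=
  (mulExp κ p.1, fun j => mulExp κ (p.2 j) + (Complex.I * (κ j : ℂ)) • mulExp κ p.1)

theorem phase_phase_neg (κ : E d) (p : L2Q d × (Fin d → L2Q d)) :
    phase κ (phase (-κ) p) = p := by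
  refine Prod.ext (mulExp_mulExp_neg κ _) (funext fun j => ?_)
  simp only [phase, map_add, map_smul, mulExp_mulExp_neg]
  simp

/-- The gauge identity ∇(e^{iκ·y}u) = e^{iκ·y}(∇ + iκ)u. -/
theorem shiftGrad_zero_phase (κ : E d) (p : L2Q d × (Fin d → L2Q d)) (j : Fin d) :
    shiftGrad 0 (phase κ p) j =ᵐ[cellMeasure d] fun x => expWave κ x * shiftGrad κ p j x := by
  filter_upwards [Lp.coeFn_add (mulExp κ (p.2 j)) ((Complex.I * (κ j : ℂ)) • mulExp κ p.1),
    Lp.coeFn_smul (Complex.I * (κ j : ℂ)) (mulExp κ p.1), coeFn_mulExp κ p.1,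
    coeFn_mulExp κ (p.2 j)] with x h1 h2 h3 h4
  simp only [shiftGrad, phase]
  rw [h1, Pi.add_apply, h2, Pi.smul_apply, h3, h4]
  simp
  ring

theorem energy_phase (A : E d → Matrix (Fin d) (Fin d) ℝ) (κ : E d)
    (p q : L2Q d × (Fin d → L2Q d)) :
    energy A (shiftGrad 0 (phase κ p)) (shiftGrad 0 (phase κ q)) =
      energy A (shiftGrad κ p) (shiftGrad κ q) := by
  rw [energy_congr (shiftGrad_zero_phase κ p) (shiftGrad_zero_phase κ q)]
  refine integral_congr_ae (Filter.Eventually.of_forall fun x => ?_)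
  have h := congrArg (fun r : ℝ => (r : ℂ) ^ 2) (norm_expWave κ x)
  simp only [← Complex.mul_conj', Complex.ofReal_one, one_pow] at h
  refine Finset.sum_congr rfl fun i _ => Finset.sum_congr rfl fun j _ => ?_
  rw [map_mul]
  linear_combination
    ((A x i j : ℂ) * shiftGrad κ p j x * (starRingEnd ℂ) (shiftGrad κ q i x)) * h

/-- The solution of the homogenised resolvent problem and that of the problem on the soft component
differ by a quantity of the order of the inverse of the macroscopic stiffness `a`. -/
theorem mul_norm_sub_le (hν : 0 < ν) (hA₀ : IsCoefficient A₀) (h : EllipticOn A₀ ν (cell d))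
    (κ : E d) {a : ℝ} (ha : 0 ≤ a) {c : ℂ} {U W : Pair2 d} {f : L2Q d}
    (hUm : U ∈ sobolev Q₁) (hWm : W ∈ sobolev Q₁)
    (hU : ∀ (e : ℂ), ∀ V ∈ sobolev Q₁, inner ℂ (const d e + V.fst) (f - (const d c + U.fst)) =
      (a : ℂ) * c * (starRingEnd ℂ) e + inner ℂ (shiftL κ V) (mulMatrix hA₀ (shiftL κ U)))
    (hW : ∀ V ∈ sobolev Q₁, inner ℂ V.fst (f - W.fst) =
      inner ℂ (shiftL κ V) (mulMatrix hA₀ (shiftL κ W))) :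
    a * ‖W.fst - (const d c + U.fst)‖ ≤ 4 * ‖const d‖ ^ 2 * ‖f‖ := by
  set X : L2Q d := const d c + U.fst with hX
  have hpos : ∀ V : Pair2 d, 0 ≤ (inner ℂ (shiftL κ V) (mulMatrix hA₀ (shiftL κ V))).re :=
    fun V => le_trans (by positivity) (re_inner_mulMatrix_ge hA₀ h (shiftL κ V))
  have hcc : ((a : ℂ) * c * (starRingEnd ℂ) c).re = a * ‖c‖ ^ 2 := by
    rw [mul_assoc, Complex.mul_conj', Complex.re_ofReal_mul]
    norm_cast
  have hXX : ∀ Y : L2Q d, (inner ℂ Y Y : ℂ).re = ‖Y‖ ^ 2 := fun Y =>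
    inner_self_eq_norm_sq (𝕜 := ℂ) Y
  -- Test with (c,U) and drop the nonnegative form.
  have hXf : ‖X‖ ≤ ‖f‖ := by
    have h1 := congrArg Complex.re (hU c U hUm)
    rw [← hX, inner_sub_right, Complex.sub_re, Complex.add_re, hcc, hXX] at h1
    have h2 : (inner ℂ X f : ℂ).re ≤ ‖X‖ * ‖f‖ := re_inner_le_norm (𝕜 := ℂ) X f
    have h3 := hpos U
    have h4 : 0 ≤ a * ‖c‖ ^ 2 := by positivity
    have h5 : ‖X‖ * ‖X‖ ≤ ‖X‖ * ‖f‖ := by nlinarith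
    rcases (norm_nonneg X).eq_or_lt with h0 | h0
    · rw [← h0]; exact norm_nonneg f
    · exact le_of_mul_le_mul_left h5 h0
  -- Test with (c,0): only the stiffness term survives on the right.
  have hc : a * ‖c‖ ≤ 2 * ‖const d‖ * ‖f‖ := by
    have h1 := congrArg Complex.re (hU c 0 (Submodule.zero_mem _))
    have h0 : (0 : Pair2 d).fst = 0 := rfl
    rw [h0, add_zero, map_zero, inner_zero_left, add_zero, hcc] at h1
    have h2 : (inner ℂ (const d c) (f - X) : ℂ).re ≤ ‖const d c‖ * ‖f - X‖ :=
      re_inner_le_norm (𝕜 := ℂ) _ _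
    have h3 : ‖f - X‖ ≤ 2 * ‖f‖ := (norm_sub_le _ _).trans (by linarith)
    have h4 : ‖const d c‖ ≤ ‖const d‖ * ‖c‖ := (const d).le_opNorm c
    have h5 : ‖c‖ * (a * ‖c‖) ≤ ‖c‖ * (2 * ‖const d‖ * ‖f‖) := by
      calc ‖c‖ * (a * ‖c‖) = a * ‖c‖ ^ 2 := by ring
        _ ≤ ‖const d c‖ * ‖f - X‖ := by rw [← h1]; exact h2
        _ ≤ (‖const d‖ * ‖c‖) * (2 * ‖f‖) := by gcongr
        _ = _ := by ring
    rcases (norm_nonneg c).eq_or_lt with h0 | h0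
    · rw [← h0, mul_zero]; positivity
    · exact le_of_mul_le_mul_left h5 h0
  -- Test both problems with U − W and e = 0. The datum cancels and −c remains as source.
  have hD : ‖(U - W).fst‖ ≤ ‖const d c‖ := by
    have hm := Submodule.sub_mem _ hUm hWm
    have h1 := hU 0 _ hm
    have h2 := hW _ hm
    have h3 : inner ℂ (U - W).fst (-(U - W).fst - const d c) =
        inner ℂ (shiftL κ (U - W)) (mulMatrix hA₀ (shiftL κ (U - W))) := by
      have h4 : -(U - W).fst - const d c = (f - X) - (f - W.fst) := by
        rw [WithLp.sub_fst, hX]; abel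
      rw [map_zero, zero_add, map_zero, mul_zero, zero_add] at h1
      rw [h4, inner_sub_right, h1, h2, ← inner_sub_right, ← map_sub, ← map_sub]
    have h4 := congrArg Complex.re h3
    rw [inner_sub_right, inner_neg_right, Complex.sub_re, Complex.neg_re, hXX] at h4
    have h5 := hpos (U - W)
    have h6 : -(inner ℂ (U - W).fst (const d c) : ℂ).re ≤ ‖(U - W).fst‖ * ‖const d c‖ :=
      (neg_le_abs _).trans ((Complex.abs_re_le_norm _).trans (norm_inner_le_norm _ _))
    have h7 : ‖(U - W).fst‖ * ‖(U - W).fst‖ ≤ ‖(U - W).fst‖ * ‖const d c‖ := by nlinarith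
    rcases (norm_nonneg (U - W).fst).eq_or_lt with h0 | h0
    · rw [← h0]; exact norm_nonneg _
    · exact le_of_mul_le_mul_left h7 h0
  have hfin : ‖W.fst - X‖ ≤ 2 * (‖const d‖ * ‖c‖) := by
    have h1 : W.fst - X = -((U - W).fst + const d c) := by
      rw [WithLp.sub_fst, hX]; abel
    rw [h1, norm_neg]
    linarith [norm_add_le (U - W).fst (const d c), (const d).le_opNorm c]
  calc a * ‖W.fst - X‖ ≤ a * (2 * (‖const d‖ * ‖c‖)) := by gcongr
    _ = 2 * ‖const d‖ * (a * ‖c‖) := by ring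
    _ ≤ 2 * ‖const d‖ * (2 * ‖const d‖ * ‖f‖) := by gcongr
    _ = _ := by ring

end Comparison

end DoublePorosity

theorem corollary8p2 {d : ℕ} (Q₁ : Set (E d)) (A₀ A₁ : E d → Matrix (Fin d) (Fin d) ℝ) (ν : ℝ)
    (hν : 0 < ν) (hQ : IsStiffSet Q₁) (hA₀ : IsCoefficient A₀) (hA₁ : IsCoefficient A₁)
    (hA₀_ell : EllipticOn A₀ ν (cell d)) (hA₁_ell : EllipticOn A₁ ν Q₁)
    (hA₁_soft : ∀ᵐ x ∂(volume.restrict (soft Q₁)), A₁ x = 0) :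
    ∃ (J : (ℂ × L2soft Q₁) ≃L[ℂ] calL Q₁) (R₀ : L2soft Q₁ →L[ℂ] L2soft Q₁)
      (Rhom : ℝ → E d → ((ℂ × L2soft Q₁) →L[ℂ] (ℂ × L2soft Q₁))),
      (∀ p, ((J p : calL Q₁) : L2Q d) = ident Q₁ p) ∧
      IsResolvent (B0 Q₁ A₀) R₀ ∧
      (∀ ε : ℝ, 0 < ε → ∀ θ : E d, ε • θ ∈ dualCell d →
        IsResolvent (Bhom Q₁ A₀ A₁ ε θ) (Rhom ε θ)) ∧
      ∃ C : ℝ, 0 < C ∧ ∀ ε : ℝ, 0 < ε → ∀ θ : E d, ε • θ ∈ dualCell d →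
        ε ^ (-(1 / 2) : ℝ) ≤ ‖θ‖ →
        ‖mulExp (-(ε • θ)) ∘L (L2soft Q₁).subtypeL ∘L R₀ ∘L
              (L2soft Q₁).orthogonalProjectionOnto ∘L mulExp (ε • θ) -
            (calL Q₁).subtypeL ∘L (J : (ℂ × L2soft Q₁) →L[ℂ] calL Q₁) ∘L Rhom ε θ ∘L
              (J.symm : calL Q₁ →L[ℂ] (ℂ × L2soft Q₁)) ∘L
              (calL Q₁).orthogonalProjectionOnto‖ ≤ C * ε := by
  obtain ⟨c₀, hc₀, hhom⟩ := exists_le_homForm hν hQ hA₁ hA₁_ell hA₁_soft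
  have hhom0 : ∀ θ, 0 ≤ homForm A₁ θ := fun θ => le_trans (by positivity) (hhom θ)
  obtain ⟨J, hJ⟩ := exists_identEquiv hQ
  obtain ⟨R₀, hR₀⟩ := exists_isResolvent_B0 (Q₁ := Q₁) hν hA₀ hA₀_ell
  choose Rhom hRhom using fun (ε : ℝ) (θ : E d) =>
    exists_isResolvent_Bhom (A₁ := A₁) (ε := ε) hν hQ hA₀ hA₀_ell (hhom0 θ)
  -- The summand 1 in the constant only makes it positive.
  refine ⟨J, R₀, Rhom, hJ, hR₀, fun ε _ θ _ => hRhom ε θ,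
    (4 * ‖const d‖ ^ 2 + 1) / c₀, by positivity, fun ε hε θ _ hθ => ?_⟩
  refine ContinuousLinearMap.opNorm_le_bound _ (by positivity) fun f => ?_
  set κ : E d := ε • θ with hκ
  set q : ℂ × L2soft Q₁ := J.symm ((calL Q₁).orthogonalProjectionOnto f) with hq
  set p : ℂ × L2soft Q₁ := Rhom ε θ q with hp
  set z : L2soft Q₁ := R₀ ((L2soft Q₁).orthogonalProjectionOnto (mulExp κ f)) with hz
  have hident : ∀ r s : ℂ × L2soft Q₁, ident Q₁ (r - s) = ident Q₁ r - ident Q₁ s :=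
    fun r s => map_sub (identL Q₁) r s
  have hqf : ident Q₁ q = ((calL Q₁).orthogonalProjectionOnto f : calL Q₁) := by
    rw [← hJ, hq, ContinuousLinearEquiv.apply_symm_apply]
  have hgoal : (mulExp (-κ) ∘L (L2soft Q₁).subtypeL ∘L R₀ ∘L
        (L2soft Q₁).orthogonalProjectionOnto ∘L mulExp κ -
      (calL Q₁).subtypeL ∘L (J : (ℂ × L2soft Q₁) →L[ℂ] calL Q₁) ∘L Rhom ε θ ∘L
        (J.symm : calL Q₁ →L[ℂ] (ℂ × L2soft Q₁)) ∘L
        (calL Q₁).orthogonalProjectionOnto) f = mulExp (-κ) (z : L2Q d) - ident Q₁ p := by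
    rw [← hJ]; rfl
  rw [hgoal]
  obtain ⟨g, hg, hU⟩ := (hRhom ε θ q p).1 rfl
  obtain ⟨gz, hgz, hZ⟩ := (hR₀ _ z).1 rfl
  have hWm := mulExp_mem_H10 (-κ) hgz
  have key := mul_norm_sub_le (Q₁ := Q₁) hν hA₀ hA₀_ell κ (hhom0 θ) (c := p.1)
    (U := mkPair p.2 g) (W := mkPair (phase (-κ) (z, gz)).1 (phase (-κ) (z, gz)).2) (f := f)
    hg hWm ?_ ?_
  -- The only use of |θ| ≥ ε^{-1/2}: it turns 1/(c₀|θ|²) into at most ε/c₀.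
  · have hθ2 : 1 ≤ ε * ‖θ‖ ^ 2 := by
      have h1 : (ε ^ (-(1 / 2) : ℝ)) ^ 2 ≤ ‖θ‖ ^ 2 := pow_le_pow_left₀ (by positivity) hθ 2
      rw [← Real.rpow_natCast, ← Real.rpow_mul hε.le] at h1
      norm_num [Real.rpow_neg_one] at h1
      rwa [inv_le_iff_one_le_mul₀' hε] at h1
    change homForm A₁ θ * ‖mulExp (-κ) (z : L2Q d) - ident Q₁ p‖ ≤ _ at key
    set N := ‖mulExp (-κ) (z : L2Q d) - ident Q₁ p‖ with hN
    have hN0 : 0 ≤ N := norm_nonneg _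
    rw [div_mul_eq_mul_div, div_mul_eq_mul_div, le_div_iff₀ hc₀]
    calc N * c₀ ≤ N * c₀ * (ε * ‖θ‖ ^ 2) := le_mul_of_one_le_right (by positivity) hθ2
      _ = ε * ((c₀ * ‖θ‖ ^ 2) * N) := by ring
      _ ≤ ε * (homForm A₁ θ * N) := by gcongr; exact hhom θ
      _ ≤ ε * (4 * ‖const d‖ ^ 2 * ‖f‖) := by gcongr
      _ ≤ (4 * ‖const d‖ ^ 2 + 1) * ε * ‖f‖ := by nlinarith [mul_nonneg hε.le (norm_nonneg f)]
  · intro e V hV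
    have h1 := hU e ⟨V.fst, fst_mem_L2soft (mem_sobolev.1 hV)⟩ (fun j => V.snd j) hV
    rw [hident, hqf] at h1
    rw [← energy_shiftGrad]
    refine Eq.trans ?_ h1
    -- Test functions lie in 𝓛, so the projected datum may be replaced by f.
    have hmem : const d e + V.fst ∈ calL Q₁ :=
      identL_mem_calL hQ (e, ⟨V.fst, fst_mem_L2soft (mem_sobolev.1 hV)⟩)
    change inner ℂ (const d e + V.fst) (f - ident Q₁ p) = inner ℂ (const d e + V.fst) _
    have h2 : inner ℂ (const d e + V.fst) ((calL Q₁).orthogonalProjectionOnto f : L2Q d) =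
        inner ℂ (const d e + V.fst) f :=
      Submodule.inner_orthogonalProjectionOnto_eq_of_mem_left ⟨_, hmem⟩ f
    rw [inner_sub_right, inner_sub_right, h2]
  · intro V hV
    have hVs := fst_mem_L2soft (mem_sobolev.1 hV)
    -- Testing the unshifted problem with e^{iκ·y}V yields the shifted problem for W = e^{-iκ·y}z.
    have h1 := hZ ⟨_, mulExp_mem_L2soft κ hVs⟩ _ (mulExp_mem_H10 κ (mem_sobolev.1 hV))
    have h2 := energy_phase A₀ κ (phase (-κ) (z, gz)) (V.fst, fun j => V.snd j)
    rw [phase_phase_neg] at h2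
    rw [← energy_shiftGrad]
    refine Eq.trans ?_ (h1.trans h2)
    change inner ℂ V.fst (f - mulExp (-κ) (z : L2Q d)) = inner ℂ (mulExp κ V.fst)
      ((((L2soft Q₁).orthogonalProjectionOnto (mulExp κ f) : L2soft Q₁) : L2Q d) - (z : L2Q d))
    have h3 : inner ℂ (mulExp κ V.fst)
          ((L2soft Q₁).orthogonalProjectionOnto (mulExp κ f) : L2Q d) =
        inner ℂ (mulExp κ V.fst) (mulExp κ f) :=
      Submodule.inner_orthogonalProjectionOnto_eq_of_mem_left
        ⟨_, mulExp_mem_L2soft κ hVs⟩ (mulExp κ f)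
    rw [← inner_mulExp_mulExp κ V.fst, map_sub, mulExp_mulExp_neg, inner_sub_right,
      inner_sub_right, h3]
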